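/- **Theorem 5.** Let $n_1,n_2,n_3\in\mathbb N$, let $I_1,I_2,I_3$ be the three successive blocks of indices of sizes $n_1,n_2,n_3$ in $\{1,\dots,n\}$, $n=n_1+n_2+n_3$, let $a_\mu\in(0,1)$ for $1\le\mu\le n$, $\vec a_j=(a_\mu)_{\mu\in I_j}$ (a column), and let $\Theta=(\vartheta_{ij})$ be a real non-singular $3\times3$ correlation matrix. Put $\vartheta_j=\vartheta_{ik}$ for $\{i,j,k\}=\{1,2,3\}$, and let $$R_\Theta=D+(\vartheta_{ij}\,\vec a_i\vec a_j')_{i,j=1,2,3},\qquad D=\mathrm{Diag}(1-a_1^2,\dots,1-a_n^2).$$ *Notation.* $g_\alpha$ denotes the standard gamma density $x^{\alpha-1}e^{-x}/\Gamma(\alpha)$, $x>0$, $G_\alpha$ its cdf, $G_\alpha(x;y)=e^{-y}\sum_{m\ge0}G_{\alpha+m}(x)\,y^m/m!$ the non-central gamma cdf, $L_k^{(\alpha-1)}$ the generalized Laguerre polynomials, $(\alpha)_k=\alpha(\alpha+1)\cdots(\alpha+k-1)$, and for $k\in\mathbb N_0$, $\vec x_j=(x_\mu)_{\mu\in I_j}$,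 $$c_{j,k}(\vec x_j;\alpha,\vec a_j)=\binom{\alpha+k-1}{k}^{-1}\int_0^\infty\Big(\prod_{\mu\in I_j}G_\alpha\big((1-a_\mu^2)^{-1}x_\mu;(1-a_\mu^2)^{-1}a_\mu^2y\big)\Big)L_k^{(\alpha-1)}(y)\,g_\alpha(y)\,dy .$$ With $p_j=\sum_{\mu\in I_j}a_\mu^2/(1-a_\mu^2)$ and $d_j=p_j/(1+p_j)$ let $\zeta_j=d_j\cos(\gamma_j)e^{i\gamma_j}$ and $$\rho^2(\gamma_1,\gamma_2,\gamma_3)=\big|\vartheta_1^2\zeta_2\zeta_3+\vartheta_2^2\zeta_1\zeta_3+\vartheta_3^2\zeta_1\zeta_2-2\vartheta_1\vartheta_2\vartheta_3\zeta_1\zeta_2\zeta_3\big|^2,\qquad |\gamma_j|\le\tfrac{\pi}{2}.$$ (a) Suppose that $\max\rho^2<1$, the maximum being taken over all $|\gamma_1|,|\gamma_2|,|\gamma_3|\le\pi/2$. Let $\alpha>0$ be such that the $\Gamma_n(\alpha,R_\Theta)$-distribution exists, i.e. the probability distribution on $[0,\infty)^n$ with the Laplace transform $|I_n+R_\Theta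 T|^{-\alpha}$, $T=\mathrm{Diag}(t_1,\dots,t_n)$, $t_\mu\ge0$. Then for all real $x_1,\dots,x_n$ its cdf is $$F(x_1,\dots,x_n;\alpha,R_\Theta)=\sum_{k=0}^\infty\ \sum_{k_1+k_2+k_3+k_4=k}(\alpha)_k\frac{(-2)^{k_4}}{k_4!}\prod_{j=1}^3\frac{\vartheta_j^{2k_j+k_4}}{k_j!}\,c_{j,k-k_j}(\vec x_j;\alpha,\vec a_j),$$ where the inner finite sum runs over $k_1,\dots,k_4\in\mathbb N_0$ and the outer series over $k$ converges absolutely. (b) With $\tilde\vartheta_{jk}=\vartheta_{jk}\sqrt{d_jd_k}$, the condition $\sum_{1\le j<k\le3}\tilde\vartheta_{jk}^4\le1$ implies $\max\rho^2<1$. -/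

import Mathlib

open MeasureTheory ProbabilityTheory
open scoped Nat

/-- A non-singular correlation matrix: real symmetric positive definite with unit diagonal. -/
def IsNonsingularCorrelation {ι : Type*} [Fintype ι] [DecidableEq ι]
    (R : Matrix ι ι ℝ) : Prop :=
  R.PosDef ∧ ∀ i, R i i = 1

/-- `μ` is the multivariate gamma distribution `Γ_n(α, R)` (in the sense of Krishnamoorthy and
Parthasarathy): the probability distribution on the non-negative orthant with Laplace transform
`|I + R T|^{-α}`, `T = Diag(t₁, …, tₙ)`, `tᵢ ≥ 0`. -/
structure IsMultivariateGamma {ι : Type*} [Fintype ι] [DecidableEq ι]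
    (α : ℝ) (R : Matrix ι ι ℝ) (μ : Measure (ι → ℝ)) : Prop where
  isProbabilityMeasure : IsProbabilityMeasure μ
  nonneg : ∀ᵐ x ∂μ, ∀ i, 0 ≤ x i
  laplace : ∀ t : ι → ℝ, (∀ i, 0 ≤ t i) →
    ∫ x, Real.exp (-∑ i, t i * x i) ∂μ = (1 + R * Matrix.diagonal t).det ^ (-α)

/-- The matrix `R_Θ = D + (ϑ_ij a_i a_j')` with successive one-factor blocks of sizes `n j` and
`D = Diag(…, 1 - a_μ², …)`. -/
def blockCorrelation {p : ℕ} {n : Fin p → ℕ} (Θ : Matrix (Fin p) (Fin p) ℝ)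
    (a : (j : Fin p) → Fin (n j) → ℝ) :
    Matrix ((j : Fin p) × Fin (n j)) ((j : Fin p) × Fin (n j)) ℝ :=
  Matrix.diagonal (fun u => 1 - a u.1 u.2 ^ 2) +
    Matrix.of fun u v => Θ u.1 v.1 * a u.1 u.2 * a v.1 v.2

/-- The non-central gamma cdf `G_α(x; y) = e^{-y} ∑ₙ G_{α+n}(x) yⁿ / n!`, where `G_β` is the cdf of
the standard gamma distribution with shape parameter `β`. -/
noncomputable def noncentralGammaCDF (α x y : ℝ) : ℝ :=
  Real.exp (-y) * ∑' m : ℕ, cdf (gammaMeasure (α + m) 1) x * (y ^ m / (m ! : ℝ))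

/-- The generalized Laguerre polynomial `L_k^{(β)}` evaluated at `y`. -/
noncomputable def laguerreL (k : ℕ) (β y : ℝ) : ℝ :=
  ∑ m ∈ Finset.range (k + 1),
    (-1 : ℝ) ^ m * Ring.choose ((k : ℝ) + β) (k - m) * (y ^ m / (m ! : ℝ))

/-- The Laguerre coefficient `c_k(x; α, a)` of a product of non-central gamma cdfs, for one block
with factor `a` and arguments `x`. -/
noncomputable def laguerreCoeff {m : ℕ} (k : ℕ) (x : Fin m → ℝ) (α : ℝ) (a : Fin m → ℝ) : ℝ :=
  (Ring.choose (α + (k : ℝ) - 1) k)⁻¹ *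
    ∫ y in Set.Ioi (0 : ℝ),
      (∏ i, noncentralGammaCDF α ((1 - a i ^ 2)⁻¹ * x i) ((1 - a i ^ 2)⁻¹ * a i ^ 2 * y)) *
        laguerreL k (α - 1) y * gammaPDFReal α 1 y

/-- `ϑ_j = ϑ_{ik}` with `{i, j, k}` the set of the three block indices (addition in `Fin 3` is
modulo 3). -/
def oppositeCorr (Θ : Matrix (Fin 3) (Fin 3) ℝ) (j : Fin 3) : ℝ :=
  Θ (j + 1) (j + 2)

/-- `d = p / (1 + p)` with `p = ∑ a_μ² / (1 - a_μ²)`, for one block with factor `a`. -/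
noncomputable def blockRadius {m : ℕ} (a : Fin m → ℝ) : ℝ :=
  (∑ i, a i ^ 2 / (1 - a i ^ 2)) / (1 + ∑ i, a i ^ 2 / (1 - a i ^ 2))

/-- `ϑ̃_j = ϑ_{ik} (d_i d_k)^{1/2}`. -/
noncomputable def scaledCorr {n : Fin 3 → ℕ} (Θ : Matrix (Fin 3) (Fin 3) ℝ)
    (a : (j : Fin 3) → Fin (n j) → ℝ) (j : Fin 3) : ℝ :=
  oppositeCorr Θ j * Real.sqrt (blockRadius (a (j + 1)) * blockRadius (a (j + 2)))

/-- The point `ζ_j = d_j cos(γ) e^{iγ}` of the circle belonging to one block with factor `a`. -/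
noncomputable def circlePoint {m : ℕ} (a : Fin m → ℝ) (γ : ℝ) : ℂ :=
  (blockRadius a : ℂ) * (Real.cos γ : ℂ) * Complex.exp (Complex.I * (γ : ℂ))

/-- The function `ρ²(γ₁, γ₂, γ₃) =
|ϑ₁² ζ₂ ζ₃ + ϑ₂² ζ₁ ζ₃ + ϑ₃² ζ₁ ζ₂ - 2 ϑ₁ ϑ₂ ϑ₃ ζ₁ ζ₂ ζ₃|²`. -/
noncomputable def rhoSq {n : Fin 3 → ℕ} (Θ : Matrix (Fin 3) (Fin 3) ℝ)
    (a : (j : Fin 3) → Fin (n j) → ℝ) (γ : Fin 3 → ℝ) : ℝ :=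
  ‖(∑ j : Fin 3, (oppositeCorr Θ j : ℂ) ^ 2 *
        circlePoint (a (j + 1)) (γ (j + 1)) * circlePoint (a (j + 2)) (γ (j + 2)))
      - 2 * ∏ j : Fin 3, ((oppositeCorr Θ j : ℂ) * circlePoint (a j) (γ j))‖ ^ 2

/-- The convergence condition `max ρ² < 1`, the maximum being taken over all angles
`|γ_j| ≤ π / 2`. -/
def MaxRhoSqLtOne {n : Fin 3 → ℕ} (Θ : Matrix (Fin 3) (Fin 3) ℝ)
    (a : (j : Fin 3) → Fin (n j) → ℝ) : Prop :=
  ∃ M : ℝ, IsGreatest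
    (rhoSq Θ a '' {γ : Fin 3 → ℝ | ∀ j, γ j ∈ Set.Icc (-(Real.pi / 2)) (Real.pi / 2)}) M ∧ M < 1

/-- The `k`-th term of the series, the finite sum over all decompositions
`k = k₁ + k₂ + k₃ + k₄` with `k_j ∈ ℕ₀` (in Lean: `κ 0, κ 1, κ 2, κ 3`). -/
noncomputable def gammaSeriesTerm {n : Fin 3 → ℕ} (α : ℝ) (Θ : Matrix (Fin 3) (Fin 3) ℝ)
    (a : (j : Fin 3) → Fin (n j) → ℝ) (x : ((j : Fin 3) × Fin (n j)) → ℝ) (k : ℕ) : ℝ :=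
  ∑ κ ∈ Finset.Nat.antidiagonalTuple 4 k,
    (ascPochhammer ℝ k).eval α * ((-2 : ℝ) ^ κ 3 / ((κ 3)! : ℝ)) *
      ∏ j : Fin 3, (oppositeCorr Θ j ^ (2 * κ j.castSucc + κ 3) / ((κ j.castSucc)! : ℝ) *
        laguerreCoeff (k - κ j.castSucc) (fun i => x ⟨j, i⟩) α (a j))

/-! The proof compares Laplace transforms. That of the distribution function is the product of the
`t_μ⁻¹` times `|I + R_Θ T|^{-α}`. Since `R_Θ` is a diagonal matrix plus a matrix factored through
`Θ`, the determinant is the product of the `1 + (1 - a_μ²) t_μ` times `|I₃ + Θ Z|`, where `Z` is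
diagonal with entries `z_j = ∑ a_μ² t_μ / (1 + (1 - a_μ²) t_μ)`. With `u_j = z_j / (1 + z_j)` the
small determinant equals `∏ (1 + z_j) · (1 - P(u))`, where `P` is the polynomial inside `ρ²`
(`det_one_add_blockCorrelation_mul_diagonal`, `det_one_add_corr_mul_diagonal`). The binomial series
of `(1 - P)^{-α}` and the multinomial theorem for `P^k` produce monomials in the `u_j`. A
non-central gamma cdf has a transform exponential in its mixing variable, and the Laguerre weight
turns the shared variable of a block into `(1 + z_j)^{-α} u_j^k`. Hence the `k`-th term of the
series has exactly the `k`-th term of the binomial series as its transform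
(`integral_exp_mul_gammaSeriesTerm`).

Formal inversion is justified by a uniform bound. For `re s > 0` each `u_j` lies in the disc with
diameter `[0, d_j]`, whose boundary consists of the points `ζ_j`. As `P` is affine in each variable,
the condition on `ρ²` gives `‖P‖ ≤ q < 1` on the whole polydisc. Fourier inversion on the line `re s
= 1` then bounds the `k`-th term by a constant times `(α)_k / k! · q^k · e^{∑ x}`
(`exists_norm_gammaSeriesTerm_le_geometric`). So the series converges absolutely to a continuous
function with the same transform as the cdf for all `t_μ > 1`. Uniqueness of the transform
(`ae_eq_zero_of_laplace_eq_zero`) gives equality almost everywhere, and right continuity of the cdf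
gives it everywhere.

For the sufficient condition, dividing by the unimodular factor `e^{i(γ₁+γ₂+γ₃)}` separates real and
imaginary parts. Cauchy–Schwarz together with `∏ (cos² + sin²) = 1` then gives `ρ² < 1` at every
point, and compactness gives it for the maximum. -/

open Set

/-! ### Gamma densities -/

lemma gammaPDFReal_one_of_pos {β y : ℝ} (hy : 0 < y) :
    gammaPDFReal β 1 y = (Real.Gamma β)⁻¹ * (y ^ (β - 1) * Real.exp (-y)) := by
  simp [gammaPDFReal, hy.le, mul_assoc]

lemma integrable_gammaPDFReal {β : ℝ} (hβ : 0 < β) : Integrable (gammaPDFReal β 1) := by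
  refine ⟨by fun_prop, ?_⟩
  rw [hasFiniteIntegral_iff_ofReal (ae_of_all _ (gammaPDFReal_nonneg hβ one_pos))]
  have := lintegral_gammaPDF_eq_one hβ one_pos
  simp only [gammaPDF] at this
  rw [this]; exact ENNReal.one_lt_top

lemma pow_mul_gammaPDFReal {β y : ℝ} (hβ : 0 < β) (hy : 0 < y) (m : ℕ) :
    y ^ m * gammaPDFReal β 1 y = (ascPochhammer ℝ m).eval β * gammaPDFReal (β + m) 1 y := by
  induction m with
  | zero => simp
  | succ m ih =>
    rw [pow_succ', mul_assoc, ih, ascPochhammer_succ_eval, mul_left_comm, mul_assoc]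
    congr 1
    have hm : 0 < β + m := by positivity
    rw [gammaPDFReal_one_of_pos hy, gammaPDFReal_one_of_pos hy]
    push_cast
    rw [← add_assoc, Real.Gamma_add_one hm.ne', add_sub_cancel_right, mul_inv,
      Real.rpow_sub_one hy.ne']
    field_simp

lemma integral_gammaMeasure {β : ℝ} (hβ : 0 < β) (f : ℝ → ℂ) :
    ∫ y, f y ∂(gammaMeasure β 1) = ∫ y in Ioi (0 : ℝ), f y * (gammaPDFReal β 1 y : ℂ) := by
  rw [gammaMeasure, integral_withDensity_eq_integral_toReal_smul
    (by unfold gammaPDF; fun_prop) (ae_of_all _ fun x => by simp [gammaPDF])]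
  rw [← integral_indicator measurableSet_Ioi]
  refine integral_congr_ae ?_
  filter_upwards [compl_mem_ae_iff.2 (measure_singleton (0 : ℝ))] with y hy
  by_cases h : 0 < y
  · simp [h, gammaPDF, gammaPDFReal_nonneg hβ one_pos, mul_comm]
  · have : y < 0 := lt_of_le_of_ne (not_lt.1 h) hy
    simp [h, gammaPDF_of_neg this]

lemma integrable_exp_mul_gammaMeasure {β t : ℝ} (hβ : 0 < β) (ht : t < 1) :
    Integrable (fun y => Real.exp (t * y)) (gammaMeasure β 1) ∧
      ∫ y, Real.exp (t * y) ∂(gammaMeasure β 1) = (1 - t) ^ (-β) := by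
  have key : ∫ y, Real.exp (t * y) ∂(gammaMeasure β 1) = (1 - t) ^ (-β) := by
    have h1 := integral_gammaMeasure hβ (fun y => (Real.exp (t * y) : ℂ))
    have h2 := Real.integral_rpow_mul_exp_neg_mul_Ioi hβ (sub_pos.2 ht)
    rw [integral_complex_ofReal] at h1
    apply Complex.ofReal_injective
    rw [h1]
    have h3 : ∀ y ∈ Ioi (0 : ℝ), ((Real.exp (t * y) : ℝ) : ℂ) * (gammaPDFReal β 1 y : ℂ) =
        (((Real.Gamma β)⁻¹ * (y ^ (β - 1) * Real.exp (-((1 - t) * y))) : ℝ) : ℂ) := by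
      intro y hy
      rw [gammaPDFReal_one_of_pos hy, ← Complex.ofReal_mul]
      congr 1
      rw [show -((1 - t) * y) = t * y + -y by ring, Real.exp_add]; ring
    rw [setIntegral_congr_fun measurableSet_Ioi h3, integral_complex_ofReal, integral_const_mul, h2]
    congr 1
    rw [one_div, Real.inv_rpow (sub_pos.2 ht).le, Real.rpow_neg (sub_pos.2 ht).le]
    field_simp [(Real.Gamma_pos_of_pos hβ).ne']
  refine ⟨?_, key⟩
  -- Integrability follows from the value: the integral of a non-integrable function is `0` by
  -- convention, whereas `(1 - t)^(-β)` is positive.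
  by_contra h
  rw [integral_undef h] at key
  exact (Real.rpow_pos_of_pos (sub_pos.2 ht) _).ne key

/-- Analytic continuation: both sides are analytic in `w = -z` on `re w < 1` and agree at the real
points `-1/(n+1)`, which accumulate at `0`. -/
lemma integral_exp_neg_mul_gammaPDFReal {β : ℝ} (hβ : 0 < β) {z : ℂ} (hz : 0 ≤ z.re) :
    ∫ y in Ioi (0 : ℝ), Complex.exp (-(z * y)) * (gammaPDFReal β 1 y : ℂ) =
      (1 + z) ^ (-(β : ℂ)) := by
  have hsub : Iio (1 : ℝ) ⊆ interior (integrableExpSet id (gammaMeasure β 1)) :=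
    interior_maximal (fun t ht => (integrable_exp_mul_gammaMeasure hβ ht).1) isOpen_Iio
  have hU : IsOpen {w : ℂ | w.re < 1} := isOpen_lt Complex.continuous_re continuous_const
  have hconv : Convex ℝ {w : ℂ | w.re < 1} := convex_halfSpace_re_lt 1
  have h1 : AnalyticOnNhd ℂ (complexMGF id (gammaMeasure β 1)) {w : ℂ | w.re < 1} :=
    fun w hw => analyticOnNhd_complexMGF w (hsub hw)
  have h2 : AnalyticOnNhd ℂ (fun w : ℂ => (1 - w) ^ (-(β : ℂ))) {w : ℂ | w.re < 1} := by
    refine DifferentiableOn.analyticOnNhd (fun w hw => ?_) hU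
    refine DifferentiableAt.differentiableWithinAt ?_
    refine DifferentiableAt.cpow (by fun_prop) (by fun_prop) ?_
    left; simp only [Complex.sub_re, Complex.one_re]; simpa using hw
  have hfreq : ∃ᶠ w in nhdsWithin (0 : ℂ) {0}ᶜ, complexMGF id (gammaMeasure β 1) w =
      (1 - w) ^ (-(β : ℂ)) := by
    have ht : Filter.Tendsto (fun n : ℕ => ((-(1 / ((n : ℝ) + 1)) : ℝ) : ℂ)) Filter.atTop
        (nhdsWithin (0 : ℂ) {0}ᶜ) := by
      refine tendsto_nhdsWithin_iff.2 ⟨?_, Filter.Eventually.of_forall fun n => ?_⟩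
      · have := (tendsto_one_div_add_atTop_nhds_zero_nat (𝕜 := ℝ)).neg
        rw [neg_zero] at this
        exact (Complex.continuous_ofReal.tendsto 0).comp this
      · simp only [mem_compl_iff, mem_singleton_iff, Complex.ofReal_eq_zero]
        have : (0 : ℝ) < 1 / ((n : ℝ) + 1) := by positivity
        linarith
    refine ht.frequently (Filter.Eventually.of_forall fun n => ?_).frequently
    set t : ℝ := -(1 / ((n : ℝ) + 1))
    have : t < 1 := by
      have : (0 : ℝ) < 1 / ((n : ℝ) + 1) := by positivity
      simp only [t]; linarith
    rw [complexMGF_ofReal]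
    simp only [mgf, id]
    rw [(integrable_exp_mul_gammaMeasure hβ this).2, Complex.ofReal_cpow (by linarith)]
    push_cast; rfl
  have := h1.eqOn_of_preconnected_of_frequently_eq h2 hconv.isPreconnected
    (by simp) hfreq (show (-z) ∈ {w : ℂ | w.re < 1} by simp; linarith)
  simp only [complexMGF, sub_neg_eq_add, id] at this
  rw [integral_gammaMeasure hβ] at this
  rw [← this]; simp

/-! ### The Laguerre transform -/

lemma ring_choose_add_eq_ascPochhammer (r : ℝ) (n : ℕ) :
    Ring.choose (r + n - 1) n = (ascPochhammer ℝ n).eval r / n ! := by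
  rw [← Ring.multichoose_eq, eq_div_iff (by positivity), mul_comm, ← nsmul_eq_mul,
    Ring.factorial_nsmul_multichoose_eq_ascPochhammer, Polynomial.ascPochhammer_smeval_eq_eval]

lemma continuous_laguerreL (k : ℕ) (β : ℝ) : Continuous (laguerreL k β) := by
  unfold laguerreL; fun_prop

/-- A factor `y ^ m` only shifts the shape of a gamma density, so the Laguerre weight becomes an
alternating binomial sum of gamma densities. -/
lemma laguerreL_mul_gammaPDFReal {α y : ℝ} (hα : 0 < α) (hy : 0 < y) (k : ℕ) :
    laguerreL k (α - 1) y * gammaPDFReal α 1 y = (ascPochhammer ℝ k).eval α / k ! *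
      ∑ m ∈ Finset.range (k + 1), (-1 : ℝ) ^ m * k.choose m * gammaPDFReal (α + m) 1 y := by
  rw [laguerreL, Finset.sum_mul, Finset.mul_sum]
  refine Finset.sum_congr rfl fun m hm => ?_
  have hmk : m ≤ k := Nat.lt_succ_iff.1 (Finset.mem_range.1 hm)
  have h1 : (k : ℝ) + (α - 1) = (α + m) + ((k - m : ℕ) : ℝ) - 1 := by
    rw [Nat.cast_sub hmk]; ring
  have h2 : (ascPochhammer ℝ k).eval α =
      (ascPochhammer ℝ m).eval α * (ascPochhammer ℝ (k - m)).eval (α + m) := by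
    conv_lhs => rw [← Nat.add_sub_cancel' hmk, ← ascPochhammer_mul]
    simp
  rw [h1, ring_choose_add_eq_ascPochhammer, h2, Nat.cast_choose ℝ hmk]
  have h3 := pow_mul_gammaPDFReal hα hy m
  have e : (-1 : ℝ) ^ m * ((ascPochhammer ℝ (k - m)).eval (α + m) / (k - m)!) * (y ^ m / m !) *
      gammaPDFReal α 1 y = (-1 : ℝ) ^ m * ((ascPochhammer ℝ (k - m)).eval (α + m) / (k - m)!) *
      (y ^ m * gammaPDFReal α 1 y) / m ! := by ring
  rw [e, h3]
  field_simp

lemma integrableOn_laguerreL_mul_gammaPDFReal {α : ℝ} (hα : 0 < α) (k : ℕ) :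
    IntegrableOn (fun y => laguerreL k (α - 1) y * gammaPDFReal α 1 y) (Ioi 0) := by
  rw [integrableOn_congr_fun (fun y (hy : y ∈ Ioi (0 : ℝ)) => laguerreL_mul_gammaPDFReal hα hy k)
    measurableSet_Ioi]
  refine Integrable.const_mul (integrable_finsetSum _ fun m _ => Integrable.const_mul ?_ _) _
  exact (integrable_gammaPDFReal (by positivity)).integrableOn

lemma one_add_ne_zero_of_re_nonneg {z : ℂ} (hz : 0 ≤ z.re) : 1 + z ≠ 0 := by
  intro h
  have := congrArg Complex.re h
  simp at this; linarith

/-- Each shift of the shape by one contributes `(1 + z)⁻¹`, so the alternating sum is the binomial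
expansion of `(1 - (1 + z)⁻¹) ^ k`. -/
lemma integral_exp_neg_mul_laguerreL {α : ℝ} (hα : 0 < α) (k : ℕ) {z : ℂ} (hz : 0 ≤ z.re) :
    ∫ y in Ioi (0 : ℝ), Complex.exp (-(z * y)) *
      ((laguerreL k (α - 1) y * gammaPDFReal α 1 y : ℝ) : ℂ) =
      ((ascPochhammer ℝ k).eval α / k ! : ℝ) * ((1 + z) ^ (-(α : ℂ)) * (z / (1 + z)) ^ k) := by
  have hz1 := one_add_ne_zero_of_re_nonneg hz
  have h1 : ∀ y ∈ Ioi (0 : ℝ), Complex.exp (-(z * y)) *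
      ((laguerreL k (α - 1) y * gammaPDFReal α 1 y : ℝ) : ℂ) =
      ((ascPochhammer ℝ k).eval α / k ! : ℝ) * ∑ m ∈ Finset.range (k + 1),
        ((-1 : ℂ) ^ m * k.choose m) *
          (Complex.exp (-(z * y)) * (gammaPDFReal (α + m) 1 y : ℂ)) := by
    intro y hy
    rw [laguerreL_mul_gammaPDFReal hα hy]
    push_cast
    rw [mul_left_comm]
    congr 1
    rw [Finset.mul_sum]
    exact Finset.sum_congr rfl fun m _ => by ring
  rw [setIntegral_congr_fun measurableSet_Ioi h1, integral_const_mul, integral_finsetSum]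
  · congr 1
    simp_rw [integral_const_mul]
    have h2 : ∀ m : ℕ, ∫ y in Ioi (0 : ℝ), Complex.exp (-(z * y)) *
        (gammaPDFReal (α + m) 1 y : ℂ) = (1 + z) ^ (-(α : ℂ)) * ((1 + z)⁻¹) ^ m := by
      intro m
      rw [integral_exp_neg_mul_gammaPDFReal (by positivity) hz]
      push_cast
      rw [neg_add, Complex.cpow_add _ _ hz1, Complex.cpow_neg _ (m : ℂ), Complex.cpow_natCast,
        inv_pow]
    simp_rw [h2]
    have h3 : z / (1 + z) = -(1 + z)⁻¹ + 1 := by field_simp; ring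
    rw [h3, add_pow, Finset.mul_sum]
    refine Finset.sum_congr rfl fun m _ => ?_
    rw [neg_pow (1 + z)⁻¹]; simp; ring
  · intro m _
    refine Integrable.const_mul ?_ _
    refine Integrable.bdd_mul (c := 1)
      (integrable_gammaPDFReal (β := α + m) (by positivity)).ofReal.integrableOn
      (by fun_prop) ?_
    refine (ae_restrict_iff' measurableSet_Ioi).2 (ae_of_all _ fun y hy => ?_)
    rw [Complex.norm_exp]
    simp only [Complex.neg_re, Complex.mul_re, Complex.ofReal_re, Complex.ofReal_im, mul_zero,
      sub_zero, Real.exp_le_one_iff, Left.neg_nonpos_iff]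
    exact mul_nonneg hz (le_of_lt hy)

/-! ### Laplace transforms of distribution functions -/

/-- Fubini on `{y ≤ x}`. Cutting `e` off to `Ici 0` makes the joint integrand integrable and changes
nothing, as `0 ≤ y` almost surely. The general ordered space covers both the line and the orthant.
-/
lemma integral_mul_measureReal_Iic {X : Type*} [PartialOrder X] [Zero X] [TopologicalSpace X]
    [OrderClosedTopology X] [SecondCountableTopology X] [MeasurableSpace X] [BorelSpace X]
    {ν vol : Measure X} [IsFiniteMeasure ν] [SigmaFinite vol] (hν : ∀ᵐ y ∂ν, 0 ≤ y)
    {e : X → ℂ} (he : IntegrableOn e (Ici 0) vol) :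
    ∫ x, e x * (ν.real (Iic x) : ℂ) ∂vol = ∫ y, (∫ x in Ici y, e x ∂vol) ∂ν := by
  have hS : MeasurableSet {p : X × X | p.2 ≤ p.1} := measurableSet_le measurable_snd measurable_fst
  have hint : Integrable (fun p : X × X => {p : X × X | p.2 ≤ p.1}.indicator
      (fun p => (Ici (0 : X)).indicator e p.1 * (1 : ℂ)) p) (vol.prod ν) :=
    (((integrable_indicator_iff measurableSet_Ici).2 he).mul_prod (integrable_const _)).indicator hS
  have h1 : ∀ x, e x * (ν.real (Iic x) : ℂ) = ∫ y, {p : X × X | p.2 ≤ p.1}.indicator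
      (fun p => (Ici (0 : X)).indicator e p.1 * (1 : ℂ)) (x, y) ∂ν := by
    intro x
    have : ∀ᵐ y ∂ν, {p : X × X | p.2 ≤ p.1}.indicator
      (fun p => (Ici (0 : X)).indicator e p.1 * (1 : ℂ)) (x, y) =
        (Iic x).indicator (fun _ => e x) y := by
      filter_upwards [hν] with y hy
      by_cases h : y ≤ x
      · have : 0 ≤ x := hy.trans h
        simp [indicator, h, this]
      · simp [indicator, h]
    rw [integral_congr_ae this, integral_indicator measurableSet_Iic, setIntegral_const,
      Complex.real_smul, mul_comm]
  simp_rw [h1]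
  rw [integral_integral_swap hint]
  refine integral_congr_ae ?_
  filter_upwards [hν] with y hy
  rw [← integral_indicator measurableSet_Ici]
  refine integral_congr_ae (ae_of_all _ fun x => ?_)
  by_cases h : y ≤ x
  · have : 0 ≤ x := hy.trans h
    simp [indicator, h, this]
  · simp [indicator, h]

lemma norm_exp_neg_mul_ofReal (s : ℂ) (x : ℝ) :
    ‖Complex.exp (-(s * x))‖ = Real.exp (-(s.re * x)) := by
  rw [Complex.norm_exp]; simp

lemma integrableOn_exp_neg_mul_Ici {s : ℂ} (hs : 0 < s.re) (c : ℝ) :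
    IntegrableOn (fun x : ℝ => Complex.exp (-(s * x))) (Ici c) := by
  rw [integrableOn_Ici_iff_integrableOn_Ioi]
  have := integrableOn_exp_mul_complex_Ioi (a := -s) (by simpa using hs) c
  simpa using this

lemma integral_exp_neg_mul_Ici {s : ℂ} (hs : 0 < s.re) (c : ℝ) :
    ∫ x in Ici c, Complex.exp (-(s * x)) = s⁻¹ * Complex.exp (-(s * c)) := by
  rw [integral_Ici_eq_integral_Ioi]
  have := integral_exp_mul_complex_Ioi (a := -s) (by simpa using hs) c
  simp only [neg_mul] at this
  rw [this, neg_div_neg_eq, div_eq_inv_mul]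

lemma gammaMeasure_ae_nonneg (β : ℝ) : ∀ᵐ y ∂(gammaMeasure β 1), (0 : ℝ) ≤ y := by
  rw [gammaMeasure, ae_withDensity_iff (by unfold gammaPDF; fun_prop)]
  refine ae_of_all _ fun y hy => ?_
  by_contra h
  exact hy (gammaPDF_of_neg (not_le.1 h))

lemma continuous_cdf_gammaMeasure {β : ℝ} (hβ : 0 < β) :
    Continuous fun x => cdf (gammaMeasure β 1) x := by
  simp_rw [cdf_gammaMeasure_eq_integral hβ one_pos]
  have h := integrable_gammaPDFReal hβ
  have h0 : ∀ x : ℝ, ∫ t in Iic x, gammaPDFReal β 1 t =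
      (∫ t in Iic 0, gammaPDFReal β 1 t) + ∫ t in (0 : ℝ)..x, gammaPDFReal β 1 t := fun x => by
    rw [← intervalIntegral.integral_Iic_sub_Iic h.integrableOn h.integrableOn]; ring
  rw [funext h0]
  exact continuous_const.add (intervalIntegral.continuous_primitive
    (fun a b => h.intervalIntegrable) 0)

lemma cdf_gammaMeasure_of_nonpos {β x : ℝ} (hβ : 0 < β) (hx : x ≤ 0) :
    cdf (gammaMeasure β 1) x = 0 := by
  have := isProbabilityMeasure_gammaMeasure hβ one_pos
  rw [cdf_gammaMeasure_eq_integral hβ one_pos, setIntegral_congr_set Iio_ae_eq_Iic.symm]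
  refine (setIntegral_congr_fun (g := fun _ => (0 : ℝ)) measurableSet_Iio fun y hy => ?_).trans
    (by simp)
  have : ¬ (0 ≤ y) := not_le.2 (lt_of_lt_of_le hy hx)
  simp [gammaPDFReal, this]

lemma integral_exp_neg_mul_cdf_gammaMeasure {β b : ℝ} (hβ : 0 < β) (hb : 0 < b) {s : ℂ}
    (hs : 0 < s.re) :
    ∫ x : ℝ, Complex.exp (-(s * x)) * (cdf (gammaMeasure β 1) (b⁻¹ * x) : ℂ) =
      s⁻¹ * (1 + b * s) ^ (-(β : ℂ)) := by
  have := isProbabilityMeasure_gammaMeasure hβ one_pos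
  have hbs : 0 < ((b : ℂ) * s).re := by simpa using mul_pos hb hs
  have h1 := integral_mul_measureReal_Iic (vol := volume) (gammaMeasure_ae_nonneg β)
    (integrableOn_exp_neg_mul_Ici hbs 0)
  simp_rw [integral_exp_neg_mul_Ici hbs] at h1
  rw [integral_const_mul, integral_gammaMeasure hβ,
    integral_exp_neg_mul_gammaPDFReal hβ hbs.le] at h1
  simp_rw [← cdf_eq_real] at h1
  have h2 := Measure.integral_comp_mul_left
    (fun x : ℝ => Complex.exp (-(b * s * x)) * (cdf (gammaMeasure β 1) x : ℂ)) b⁻¹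
  rw [h1] at h2
  have hb' : (b : ℂ) ≠ 0 := by exact_mod_cast hb.ne'
  convert h2 using 1
  · congr 1; ext x; push_cast; congr 3; field_simp
  · rw [inv_inv, abs_of_pos hb, Complex.real_smul, mul_inv]; field_simp

/-! ### Non-central gamma distribution functions -/

lemma norm_noncentral_term_le {α : ℝ} (x y : ℝ) (m : ℕ) :
    ‖cdf (gammaMeasure (α + m) 1) x * (y ^ m / (m ! : ℝ))‖ ≤ |y| ^ m / (m ! : ℝ) := by
  rw [norm_mul, Real.norm_of_nonneg (cdf_nonneg _ _), norm_div, norm_pow, Real.norm_eq_abs,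
    Real.norm_of_nonneg (by positivity : (0 : ℝ) ≤ (m ! : ℝ))]
  exact mul_le_of_le_one_left (by positivity) (cdf_le_one _ _)

lemma summable_noncentral_term (α x y : ℝ) :
    Summable fun m : ℕ => cdf (gammaMeasure (α + m) 1) x * (y ^ m / (m ! : ℝ)) :=
  Summable.of_norm_bounded (Real.summable_pow_div_factorial |y|) (norm_noncentral_term_le x y)

lemma measurable_noncentralGammaCDF {α : ℝ} (hα : 0 < α) :
    Measurable fun p : ℝ × ℝ => noncentralGammaCDF α p.1 p.2 := by
  unfold noncentralGammaCDF
  refine Measurable.mul (by fun_prop) ?_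
  refine measurable_of_tendsto_metrizable (f := fun N : ℕ => fun p : ℝ × ℝ =>
    ∑ m ∈ Finset.range N, cdf (gammaMeasure (α + m) 1) p.1 * (p.2 ^ m / (m ! : ℝ))) ?_ ?_
  · intro N
    refine Finset.measurable_fun_sum _ fun m _ => ?_
    have := (continuous_cdf_gammaMeasure (β := α + m) (by positivity)).measurable
    fun_prop
  · rw [tendsto_pi_nhds]
    exact fun p => (summable_noncentral_term α p.1 p.2).hasSum.tendsto_sum_nat

lemma continuous_noncentralGammaCDF {α : ℝ} (hα : 0 < α) (y : ℝ) :
    Continuous fun x => noncentralGammaCDF α x y := by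
  refine continuous_const.mul (continuous_tsum (fun m => ?_) (Real.summable_pow_div_factorial |y|)
    fun m x => norm_noncentral_term_le x y m)
  have := continuous_cdf_gammaMeasure (β := α + m) (by positivity)
  fun_prop

lemma noncentralGammaCDF_of_nonpos {α x : ℝ} (hα : 0 < α) (hx : x ≤ 0) (y : ℝ) :
    noncentralGammaCDF α x y = 0 := by
  have : ∀ m : ℕ, cdf (gammaMeasure (α + m) 1) x = 0 := fun m =>
    cdf_gammaMeasure_of_nonpos (by positivity) hx
  simp [noncentralGammaCDF, this]

lemma noncentralGammaCDF_nonneg (α x : ℝ) {y : ℝ} (hy : 0 ≤ y) : 0 ≤ noncentralGammaCDF α x y :=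
  mul_nonneg (Real.exp_pos _).le (tsum_nonneg fun _ => mul_nonneg (cdf_nonneg _ _) (by positivity))

lemma noncentralGammaCDF_le_one (α x : ℝ) {y : ℝ} (hy : 0 ≤ y) :
    noncentralGammaCDF α x y ≤ 1 := by
  have h1 : ∑' m : ℕ, cdf (gammaMeasure (α + m) 1) x * (y ^ m / (m ! : ℝ)) ≤ Real.exp y := by
    rw [Real.exp_eq_exp_ℝ, NormedSpace.exp_eq_tsum_div]
    exact Summable.tsum_le_tsum
      (fun m => mul_le_of_le_one_left (by positivity) (cdf_le_one _ _))
      (summable_noncentral_term α x y) (Real.summable_pow_div_factorial y)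
  calc noncentralGammaCDF α x y ≤ Real.exp (-y) * Real.exp y :=
        mul_le_mul_of_nonneg_left h1 (Real.exp_pos _).le
    _ = 1 := by rw [← Real.exp_add]; simp

lemma norm_noncentralGammaCDF_le_one (α x : ℝ) {y : ℝ} (hy : 0 ≤ y) :
    ‖noncentralGammaCDF α x y‖ ≤ 1 := by
  rw [Real.norm_of_nonneg (noncentralGammaCDF_nonneg α x hy)]
  exact noncentralGammaCDF_le_one α x hy

/-- Termwise integration, dominated by the exponential series in `|y| / b`. The resulting series is
again exponential, and `e^{-y/b} · e^{(y/b)/(1+bs)}` is the last factor. -/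
lemma integral_exp_neg_mul_noncentralGammaCDF {α b : ℝ} (hα : 0 < α) (hb : 0 < b) {s : ℂ}
    (hs : 0 < s.re) (y : ℝ) :
    ∫ x : ℝ, Complex.exp (-(s * x)) * (noncentralGammaCDF α (b⁻¹ * x) (b⁻¹ * y) : ℂ) =
      s⁻¹ * (1 + b * s) ^ (-(α : ℂ)) * Complex.exp (-(s / (1 + b * s) * y)) := by
  have hbs : 0 < ((b : ℂ) * s).re := by simpa using mul_pos hb hs
  have hbs1 := one_add_ne_zero_of_re_nonneg hbs.le
  have hb' : (b : ℂ) ≠ 0 := by exact_mod_cast hb.ne'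
  set l : ℝ := b⁻¹ * y with hl
  set F : ℕ → ℝ → ℂ := fun m x => Complex.exp (-(s * x)) *
    ((cdf (gammaMeasure (α + m) 1) (b⁻¹ * x) * (l ^ m / (m ! : ℝ)) : ℝ) : ℂ) with hF
  have hFle : ∀ m x, ‖F m x‖ ≤
      |l| ^ m / (m ! : ℝ) * (Ici (0 : ℝ)).indicator (fun x => Real.exp (-(s.re * x))) x := by
    intro m x
    by_cases hx : 0 ≤ x
    · rw [hF]
      simp only [norm_mul, norm_exp_neg_mul_ofReal, Complex.norm_real, indicator, mem_Ici, hx,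
        if_true]
      rw [mul_comm]
      rw [← norm_mul]
      exact mul_le_mul_of_nonneg_right (norm_noncentral_term_le _ _ _) (Real.exp_pos _).le
    · have : cdf (gammaMeasure (α + m) 1) (b⁻¹ * x) = 0 :=
        cdf_gammaMeasure_of_nonpos (by positivity)
          (mul_nonpos_of_nonneg_of_nonpos (inv_nonneg.2 hb.le) (not_le.1 hx).le)
      simp [hF, this, hx]
  have hbd : Integrable ((Ici (0 : ℝ)).indicator (fun x => Real.exp (-(s.re * x)))) := by
    rw [integrable_indicator_iff measurableSet_Ici]
    have := (integrableOn_exp_neg_mul_Ici hs 0).norm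
    simp only [norm_exp_neg_mul_ofReal] at this
    exact this
  have hFi : ∀ m, Integrable (F m) := by
    intro m
    refine (hbd.const_mul _).mono' ?_ (ae_of_all _ (hFle m))
    have := (continuous_cdf_gammaMeasure (β := α + m) (by positivity))
    have hc : Continuous (F m) := by simp only [hF]; fun_prop
    exact hc.aestronglyMeasurable
  have hsum : Summable fun m => ∫ x, ‖F m x‖ := by
    refine Summable.of_nonneg_of_le (fun m => integral_nonneg fun x => norm_nonneg _)
      (fun m => ?_) ((Real.summable_pow_div_factorial |l|).mul_right
        (∫ x, (Ici (0 : ℝ)).indicator (fun x => Real.exp (-(s.re * x))) x))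
    rw [← integral_const_mul]
    exact integral_mono (hFi m).norm (hbd.const_mul _) (hFle m)
  have h := hasSum_integral_of_summable_integral_norm hFi hsum
  have h1 : ∀ m, ∫ x, F m x = s⁻¹ * (1 + b * s) ^ (-(α : ℂ)) *
      ((l / (1 + b * s)) ^ m / (m ! : ℂ)) := by
    intro m
    simp only [hF]
    push_cast
    simp_rw [← mul_assoc]
    rw [integral_mul_const, integral_exp_neg_mul_cdf_gammaMeasure (by positivity) hb hs]
    push_cast
    rw [neg_add, Complex.cpow_add _ _ hbs1, Complex.cpow_neg _ (m : ℂ), Complex.cpow_natCast,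
      div_pow]
    field_simp
  simp_rw [h1] at h
  have h2 := (NormedSpace.expSeries_div_hasSum_exp ((l : ℂ) / (1 + b * s))).mul_left
    (s⁻¹ * (1 + b * s) ^ (-(α : ℂ)))
  rw [← Complex.exp_eq_exp_ℂ] at h2
  have h3 := h.unique h2
  have h4 : ∀ x : ℝ, Complex.exp (-(s * x)) * (noncentralGammaCDF α (b⁻¹ * x) l : ℂ) =
      Complex.exp (-(l : ℂ)) * ∑' m, F m x := by
    intro x
    simp only [hF, noncentralGammaCDF]
    rw [tsum_mul_left]
    push_cast
    ring
  simp_rw [h4]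
  rw [integral_const_mul, h3, mul_left_comm, ← Complex.exp_add]
  congr 2
  rw [hl]; push_cast
  field_simp
  ring

/-! ### Laplace transform of a product of Laguerre coefficients -/

/-- `z = ∑ a_μ² s_μ / (1 + (1 - a_μ²) s_μ)`. -/
noncomputable def blockShift {m : ℕ} (a : Fin m → ℝ) (s : Fin m → ℂ) : ℂ :=
  ∑ i, (a i : ℂ) ^ 2 * (s i / (1 + ((1 - a i ^ 2 : ℝ) : ℂ) * s i))

/-- `u = z / (1 + z)`. -/
noncomputable def blockRatio {m : ℕ} (a : Fin m → ℝ) (s : Fin m → ℂ) : ℂ :=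
  blockShift a s / (1 + blockShift a s)

lemma one_sub_sq_pos {a : ℝ} (ha : 0 < a ∧ a < 1) : 0 < 1 - a ^ 2 := by
  nlinarith [ha.1, ha.2]

lemma re_div_one_add_mul_nonneg {b : ℝ} (hb : 0 < b) {s : ℂ} (hs : 0 < s.re) :
    0 ≤ (s / (1 + b * s)).re := by
  rw [Complex.div_re, ← add_div]
  refine div_nonneg ?_ (Complex.normSq_nonneg _)
  simp only [Complex.add_re, Complex.one_re, Complex.mul_re, Complex.ofReal_re, Complex.ofReal_im,
    Complex.add_im, Complex.one_im, Complex.mul_im]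
  nlinarith [mul_nonneg hb.le (sq_nonneg s.re), mul_nonneg hb.le (sq_nonneg s.im)]

lemma blockShift_re_nonneg {m : ℕ} {a : Fin m → ℝ} (ha : ∀ i, 0 < a i ∧ a i < 1)
    {s : Fin m → ℂ} (hs : ∀ i, 0 < (s i).re) : 0 ≤ (blockShift a s).re := by
  rw [blockShift, Complex.re_sum]
  refine Finset.sum_nonneg fun i _ => ?_
  rw [← Complex.ofReal_pow, Complex.re_ofReal_mul]
  exact mul_nonneg (sq_nonneg _) (re_div_one_add_mul_nonneg (one_sub_sq_pos (ha i)) (hs i))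

lemma norm_prod_noncentralGammaCDF_le_one {ι : Type*} (s : Finset ι) (α : ℝ) (x y : ι → ℝ)
    (hy : ∀ i, 0 ≤ y i) : ‖∏ i ∈ s, noncentralGammaCDF α (x i) (y i)‖ ≤ 1 := by
  rw [norm_prod]
  exact Finset.prod_le_one (fun _ _ => norm_nonneg _)
    fun i _ => norm_noncentralGammaCDF_le_one α _ (hy i)

lemma factor_nonneg {a y : ℝ} (ha : 0 < a ∧ a < 1) (hy : 0 ≤ y) :
    0 ≤ (1 - a ^ 2)⁻¹ * a ^ 2 * y :=
  mul_nonneg (mul_nonneg (inv_nonneg.2 (one_sub_sq_pos ha).le) (sq_nonneg _)) hy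

lemma norm_laguerreCoeff_integrand_le {m : ℕ} (k : ℕ) (x : Fin m → ℝ) (α : ℝ) {a : Fin m → ℝ}
    (ha : ∀ i, 0 < a i ∧ a i < 1) {y : ℝ} (hy : 0 < y) :
    ‖(∏ i, noncentralGammaCDF α ((1 - a i ^ 2)⁻¹ * x i) ((1 - a i ^ 2)⁻¹ * a i ^ 2 * y)) *
        laguerreL k (α - 1) y * gammaPDFReal α 1 y‖ ≤
      ‖laguerreL k (α - 1) y * gammaPDFReal α 1 y‖ := by
  rw [mul_assoc, norm_mul]
  refine mul_le_of_le_one_left (norm_nonneg _) ?_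
  exact norm_prod_noncentralGammaCDF_le_one _ _ _ _ fun i => factor_nonneg (ha i) hy.le

lemma measurable_prod_noncentralGammaCDF {m : ℕ} (x : Fin m → ℝ) {α : ℝ} (hα : 0 < α)
    (a : Fin m → ℝ) : Measurable fun y : ℝ =>
      ∏ i, noncentralGammaCDF α ((1 - a i ^ 2)⁻¹ * x i) ((1 - a i ^ 2)⁻¹ * a i ^ 2 * y) := by
  refine Finset.measurable_fun_prod _ fun i _ => ?_
  exact (measurable_noncentralGammaCDF hα).comp
    (measurable_const.prodMk (measurable_const.mul measurable_id))

lemma continuous_laguerreCoeff {m : ℕ} (k : ℕ) {α : ℝ} (hα : 0 < α) {a : Fin m → ℝ}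
    (ha : ∀ i, 0 < a i ∧ a i < 1) : Continuous fun x : Fin m → ℝ => laguerreCoeff k x α a := by
  unfold laguerreCoeff
  refine continuous_const.mul ?_
  refine continuous_of_dominated (bound := fun y => ‖laguerreL k (α - 1) y * gammaPDFReal α 1 y‖)
    (fun x => ?_) (fun x => ?_) (integrableOn_laguerreL_mul_gammaPDFReal hα k).norm ?_
  · exact (((measurable_prod_noncentralGammaCDF x hα a).mul
      (continuous_laguerreL _ _).measurable).mul (by fun_prop)).aestronglyMeasurable
  · exact (ae_restrict_iff' measurableSet_Ioi).2 (ae_of_all _ fun y hy =>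
      norm_laguerreCoeff_integrand_le k x α ha hy)
  · refine ae_of_all _ fun y => ?_
    refine (Continuous.mul ?_ continuous_const).mul continuous_const
    refine continuous_finsetProd _ fun i _ => ?_
    exact (continuous_noncentralGammaCDF hα _).comp (continuous_const.mul (continuous_apply i))

lemma exists_norm_laguerreCoeff_le {m : ℕ} (k : ℕ) {α : ℝ} (hα : 0 < α) {a : Fin m → ℝ}
    (ha : ∀ i, 0 < a i ∧ a i < 1) : ∃ C, ∀ x : Fin m → ℝ, ‖laguerreCoeff k x α a‖ ≤ C := by
  refine ⟨‖(Ring.choose (α + (k : ℝ) - 1) k)⁻¹‖ *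
    ∫ y in Ioi (0 : ℝ), ‖laguerreL k (α - 1) y * gammaPDFReal α 1 y‖, fun x => ?_⟩
  rw [laguerreCoeff, norm_mul]
  refine mul_le_mul_of_nonneg_left ?_ (norm_nonneg _)
  refine norm_integral_le_of_norm_le (integrableOn_laguerreL_mul_gammaPDFReal hα k).norm ?_
  exact (ae_restrict_iff' measurableSet_Ioi).2 (ae_of_all _ fun y hy =>
      norm_laguerreCoeff_integrand_le k x α ha hy)

lemma laguerreCoeff_of_nonpos {m : ℕ} (k : ℕ) {α : ℝ} (hα : 0 < α) {a : Fin m → ℝ}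
    (ha : ∀ i, 0 < a i ∧ a i < 1) {x : Fin m → ℝ} {i : Fin m} (hx : x i ≤ 0) :
    laguerreCoeff k x α a = 0 := by
  have : ∀ y : ℝ, ∏ i, noncentralGammaCDF α ((1 - a i ^ 2)⁻¹ * x i)
      ((1 - a i ^ 2)⁻¹ * a i ^ 2 * y) = 0 := fun y =>
    Finset.prod_eq_zero (Finset.mem_univ i) (noncentralGammaCDF_of_nonpos hα
      (mul_nonpos_of_nonneg_of_nonpos (inv_nonneg.2 (one_sub_sq_pos (ha i)).le) hx) _)
  simp [laguerreCoeff, this]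

lemma integrable_indicator_exp_neg_mul {c : ℝ} (hc : 0 < c) :
    Integrable ((Ici (0 : ℝ)).indicator (fun x => Real.exp (-(c * x)))) := by
  rw [integrable_indicator_iff measurableSet_Ici]
  have := (integrableOn_exp_neg_mul_Ici (s := c) (by simpa using hc) 0).norm
  simp only [norm_exp_neg_mul_ofReal] at this
  exact this

section Blocks

variable {p : ℕ} {n : Fin p → ℕ}

/-- The joint integrand in the variables `x_μ` and the mixing variables `y_j`. -/
noncomputable def mixedIntegrand (α : ℝ) (a : (j : Fin p) → Fin (n j) → ℝ) (k : Fin p → ℕ)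
    (s : ((j : Fin p) × Fin (n j)) → ℂ) (x : ((j : Fin p) × Fin (n j)) → ℝ) (y : Fin p → ℝ) : ℂ :=
  (∏ u : (j : Fin p) × Fin (n j), Complex.exp (-(s u * x u)) *
    (noncentralGammaCDF α ((1 - a u.1 u.2 ^ 2)⁻¹ * x u)
      ((1 - a u.1 u.2 ^ 2)⁻¹ * a u.1 u.2 ^ 2 * y u.1) : ℂ)) *
  ∏ j, (((Ioi (0 : ℝ)).indicator
    (fun t => laguerreL (k j) (α - 1) t * gammaPDFReal α 1 t) (y j) : ℝ) : ℂ)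

/-- This licenses Fubini between the arguments `x` and the mixing variables `y`. The cdfs are at
most `1` for positive `y` and vanish at negative arguments, leaving a product of one-dimensional
integrable majorants. -/
lemma integrable_mixedIntegrand {α : ℝ} (hα : 0 < α) {a : (j : Fin p) → Fin (n j) → ℝ}
    (ha : ∀ j i, 0 < a j i ∧ a j i < 1) (k : Fin p → ℕ) {s : ((j : Fin p) × Fin (n j)) → ℂ}
    (hs : ∀ u, 0 < (s u).re) :
    Integrable (fun q : (((j : Fin p) × Fin (n j)) → ℝ) × (Fin p → ℝ) =>
      mixedIntegrand α a k s q.1 q.2) (volume.prod volume) := by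
  have h1 : Integrable (fun x : ((j : Fin p) × Fin (n j)) → ℝ =>
      ∏ u, (Ici (0 : ℝ)).indicator (fun x => Real.exp (-((s u).re * x))) (x u)) :=
    Integrable.fintype_prod (f := fun u =>
      (Ici (0 : ℝ)).indicator (fun x => Real.exp (-((s u).re * x))))
      fun u => integrable_indicator_exp_neg_mul (hs u)
  have h2 : Integrable (fun y : Fin p → ℝ => ∏ j, ‖(Ioi (0 : ℝ)).indicator
    (fun t => laguerreL (k j) (α - 1) t * gammaPDFReal α 1 t) (y j)‖) :=
    Integrable.fintype_prod (f := fun j t => ‖(Ioi (0 : ℝ)).indicator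
    (fun t => laguerreL (k j) (α - 1) t * gammaPDFReal α 1 t) t‖) fun j =>
      ((integrable_indicator_iff measurableSet_Ioi).2
        (integrableOn_laguerreL_mul_gammaPDFReal hα (k j))).norm
  refine (h1.mul_prod h2).mono' (Measurable.aestronglyMeasurable ?_) (ae_of_all _ ?_)
  · unfold mixedIntegrand
    refine Measurable.mul (Finset.measurable_fun_prod _ fun u _ => ?_)
      (Finset.measurable_fun_prod _ fun j _ => ?_)
    · refine Measurable.mul (by fun_prop) (Complex.measurable_ofReal.comp ?_)
      exact (measurable_noncentralGammaCDF hα).comp (Measurable.prodMk (by fun_prop) (by fun_prop))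
    · refine Complex.measurable_ofReal.comp ?_
      have hm : Measurable fun t => laguerreL (k j) (α - 1) t * gammaPDFReal α 1 t :=
        (continuous_laguerreL _ _).measurable.mul (by fun_prop)
      exact (hm.indicator measurableSet_Ioi).comp (by fun_prop)
  · rintro ⟨x, y⟩
    by_cases hy : ∀ j, 0 < y j
    · simp only [mixedIntegrand, norm_mul, norm_prod, Complex.norm_real]
      refine mul_le_mul_of_nonneg_right ?_ (Finset.prod_nonneg fun _ _ => norm_nonneg _)
      refine Finset.prod_le_prod (fun _ _ => by positivity) fun u _ => ?_
      by_cases hx : 0 ≤ x u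
      · simp only [norm_exp_neg_mul_ofReal, indicator, mem_Ici, hx, if_true]
        exact mul_le_of_le_one_right (Real.exp_pos _).le
          (norm_noncentralGammaCDF_le_one α _ (factor_nonneg (ha u.1 u.2) (hy u.1).le))
      · rw [noncentralGammaCDF_of_nonpos hα (mul_nonpos_of_nonneg_of_nonpos
          (inv_nonneg.2 (one_sub_sq_pos (ha u.1 u.2)).le) (not_le.1 hx).le)]
        simp [hx]
    · push Not at hy
      obtain ⟨j, hj⟩ := hy
      have : ∏ j, (((Ioi (0 : ℝ)).indicator
        (fun t => laguerreL (k j) (α - 1) t * gammaPDFReal α 1 t) (y j) : ℝ) : ℂ) = 0 :=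
        Finset.prod_eq_zero (Finset.mem_univ j) (by simp [hj.not_gt])
      simp only [mixedIntegrand, this, mul_zero, norm_zero]
      refine mul_nonneg (Finset.prod_nonneg fun u _ => ?_)
        (Finset.prod_nonneg fun _ _ => norm_nonneg _)
      exact indicator_nonneg (fun _ _ => (Real.exp_pos _).le) _

lemma integral_mixedIntegrand_left {α : ℝ} (hα : 0 < α) {a : (j : Fin p) → Fin (n j) → ℝ}
    (ha : ∀ j i, 0 < a j i ∧ a j i < 1) (k : Fin p → ℕ) {s : ((j : Fin p) × Fin (n j)) → ℂ}
    (hs : ∀ u, 0 < (s u).re) (y : Fin p → ℝ) :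
    ∫ x, mixedIntegrand α a k s x y =
      (∏ u, (s u)⁻¹ * (1 + ((1 - a u.1 u.2 ^ 2 : ℝ) : ℂ) * s u) ^ (-(α : ℂ))) *
      ∏ j, (Complex.exp (-(blockShift (a j) (fun i => s ⟨j, i⟩) * y j)) *
        (((Ioi (0 : ℝ)).indicator
          (fun t => laguerreL (k j) (α - 1) t * gammaPDFReal α 1 t) (y j) : ℝ) : ℂ)) := by
  unfold mixedIntegrand
  rw [integral_mul_const, integral_fintype_prod_volume_eq_prod (fun u (x : ℝ) =>
    Complex.exp (-(s u * x)) * (noncentralGammaCDF α ((1 - a u.1 u.2 ^ 2)⁻¹ * x)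
      ((1 - a u.1 u.2 ^ 2)⁻¹ * a u.1 u.2 ^ 2 * y u.1) : ℂ))]
  have h : ∀ u : (j : Fin p) × Fin (n j), ∫ x : ℝ, Complex.exp (-(s u * x)) *
      (noncentralGammaCDF α ((1 - a u.1 u.2 ^ 2)⁻¹ * x)
      ((1 - a u.1 u.2 ^ 2)⁻¹ * a u.1 u.2 ^ 2 * y u.1) : ℂ) =
      ((s u)⁻¹ * (1 + ((1 - a u.1 u.2 ^ 2 : ℝ) : ℂ) * s u) ^ (-(α : ℂ))) *
      Complex.exp (-((a u.1 u.2 : ℂ) ^ 2 * (s u / (1 + ((1 - a u.1 u.2 ^ 2 : ℝ) : ℂ) * s u)) *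
        y u.1)) := by
    intro u
    simp_rw [mul_assoc (1 - a u.1 u.2 ^ 2)⁻¹]
    rw [integral_exp_neg_mul_noncentralGammaCDF hα (one_sub_sq_pos (ha u.1 u.2)) (hs u)]
    congr 3
    push_cast; ring
  simp_rw [h]
  rw [Finset.prod_mul_distrib, mul_assoc]
  congr 1
  rw [Fintype.prod_sigma, ← Finset.prod_mul_distrib]
  refine Finset.prod_congr rfl fun j _ => ?_
  congr 1
  rw [← Complex.exp_sum, blockShift, Finset.sum_mul, ← Finset.sum_neg_distrib]

/-- Integrating over `x` first, the exponentials of one block combine to `exp (-z_j y_j)` because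
they share `y_j`; what remains is a Laguerre transform at `z_j`. Its constant `(α)_k / k!` cancels
the normalisation of `laguerreCoeff`. -/
lemma integral_exp_mul_prod_laguerreCoeff {α : ℝ} (hα : 0 < α) {a : (j : Fin p) → Fin (n j) → ℝ}
    (ha : ∀ j i, 0 < a j i ∧ a j i < 1) (k : Fin p → ℕ) {s : ((j : Fin p) × Fin (n j)) → ℂ}
    (hs : ∀ u, 0 < (s u).re) :
    ∫ x : ((j : Fin p) × Fin (n j)) → ℝ, (∏ u, Complex.exp (-(s u * x u))) *
      ((∏ j, laguerreCoeff (k j) (fun i => x ⟨j, i⟩) α (a j) : ℝ) : ℂ) =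
    (∏ u, (s u)⁻¹ * (1 + ((1 - a u.1 u.2 ^ 2 : ℝ) : ℂ) * s u) ^ (-(α : ℂ))) *
      ∏ j, ((1 + blockShift (a j) (fun i => s ⟨j, i⟩)) ^ (-(α : ℂ)) *
        blockRatio (a j) (fun i => s ⟨j, i⟩) ^ k j) := by
  set c : Fin p → ℝ := fun j => (ascPochhammer ℝ (k j)).eval α / (k j)! with hc
  have hc0 : ∀ j, (c j : ℂ) ≠ 0 := fun j => by
    have : 0 < c j := div_pos (ascPochhammer_pos _ _ hα) (by positivity)
    exact_mod_cast this.ne'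
  have h1 : ∀ x : ((j : Fin p) × Fin (n j)) → ℝ, (∏ u, Complex.exp (-(s u * x u))) *
      ((∏ j, laguerreCoeff (k j) (fun i => x ⟨j, i⟩) α (a j) : ℝ) : ℂ) =
      (∏ j, (c j : ℂ))⁻¹ * ∫ y, mixedIntegrand α a k s x y := by
    intro x
    have h2 : ∀ y, mixedIntegrand α a k s x y = (∏ u, Complex.exp (-(s u * x u))) *
        ∏ j, (((Ioi (0 : ℝ)).indicator (fun t =>
          (∏ i, noncentralGammaCDF α ((1 - a j i ^ 2)⁻¹ * x ⟨j, i⟩)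
            ((1 - a j i ^ 2)⁻¹ * a j i ^ 2 * t)) *
          laguerreL (k j) (α - 1) t * gammaPDFReal α 1 t) (y j) : ℝ) : ℂ) := by
      intro y
      rw [mixedIntegrand, Finset.prod_mul_distrib, mul_assoc]
      congr 1
      rw [Fintype.prod_sigma, ← Finset.prod_mul_distrib]
      refine Finset.prod_congr rfl fun j _ => ?_
      by_cases hj : 0 < y j
      · simp only [indicator, mem_Ioi, hj, if_true]; push_cast; ring
      · simp [hj]
    simp_rw [h2]
    rw [integral_const_mul, integral_fintype_prod_volume_eq_prod (fun j (t : ℝ) =>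
      (((Ioi (0 : ℝ)).indicator (fun t =>
          (∏ i, noncentralGammaCDF α ((1 - a j i ^ 2)⁻¹ * x ⟨j, i⟩)
            ((1 - a j i ^ 2)⁻¹ * a j i ^ 2 * t)) *
          laguerreL (k j) (α - 1) t * gammaPDFReal α 1 t) t : ℝ) : ℂ)), mul_left_comm]
    congr 1
    rw [← Finset.prod_inv_distrib, ← Finset.prod_mul_distrib, Complex.ofReal_prod]
    refine Finset.prod_congr rfl fun j _ => ?_
    rw [integral_complex_ofReal, integral_indicator measurableSet_Ioi, laguerreCoeff,
      ring_choose_add_eq_ascPochhammer]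
    simp only [hc]; push_cast; rfl
  simp_rw [h1]
  rw [integral_const_mul, integral_integral_swap (integrable_mixedIntegrand hα ha k hs)]
  simp_rw [integral_mixedIntegrand_left hα ha k hs]
  rw [integral_const_mul, integral_fintype_prod_volume_eq_prod (fun j (t : ℝ) =>
    Complex.exp (-(blockShift (a j) (fun i => s ⟨j, i⟩) * t)) *
        (((Ioi (0 : ℝ)).indicator
          (fun t => laguerreL (k j) (α - 1) t * gammaPDFReal α 1 t) t : ℝ) : ℂ)), mul_left_comm]
  congr 1
  rw [← Finset.prod_inv_distrib, ← Finset.prod_mul_distrib]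
  refine Finset.prod_congr rfl fun j _ => ?_
  have h3 : ∀ t : ℝ, Complex.exp (-(blockShift (a j) (fun i => s ⟨j, i⟩) * t)) *
        (((Ioi (0 : ℝ)).indicator
          (fun t => laguerreL (k j) (α - 1) t * gammaPDFReal α 1 t) t : ℝ) : ℂ) =
      (Ioi (0 : ℝ)).indicator (fun t : ℝ =>
        Complex.exp (-(blockShift (a j) (fun i => s ⟨j, i⟩) * t)) *
        ((laguerreL (k j) (α - 1) t * gammaPDFReal α 1 t : ℝ) : ℂ)) t := by
    intro t
    by_cases ht : 0 < t <;> simp [ht]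
  simp_rw [h3]
  rw [integral_indicator measurableSet_Ioi, integral_exp_neg_mul_laguerreL hα (k j)
    (blockShift_re_nonneg (ha j) fun i => hs _), ← mul_assoc]
  have := hc0 j
  simp only [hc] at this ⊢
  rw [inv_mul_cancel₀ this, one_mul]; rfl

end Blocks

/-! ### The terms of the series -/

/-- The polynomial `ϑ₁² u₂ u₃ + ϑ₂² u₁ u₃ + ϑ₃² u₁ u₂ - 2 ϑ₁ ϑ₂ ϑ₃ u₁ u₂ u₃`. -/
noncomputable def corrPoly (Θ : Matrix (Fin 3) (Fin 3) ℝ) (u : Fin 3 → ℂ) : ℂ :=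
  (∑ j : Fin 3, (oppositeCorr Θ j : ℂ) ^ 2 * u (j + 1) * u (j + 2))
      - 2 * ∏ j : Fin 3, ((oppositeCorr Θ j : ℂ) * u j)

lemma corrPoly_eq (Θ : Matrix (Fin 3) (Fin 3) ℝ) (u : Fin 3 → ℂ) :
    corrPoly Θ u = (oppositeCorr Θ 0 : ℂ) ^ 2 * u 1 * u 2 + (oppositeCorr Θ 1 : ℂ) ^ 2 * u 2 * u 0 +
      (oppositeCorr Θ 2 : ℂ) ^ 2 * u 0 * u 1 - 2 * ((oppositeCorr Θ 0 : ℂ) * u 0 *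
        ((oppositeCorr Θ 1 : ℂ) * u 1) * ((oppositeCorr Θ 2 : ℂ) * u 2)) := by
  simp only [corrPoly, Fin.sum_univ_three, Fin.prod_univ_three]
  rfl

lemma antidiagonalTuple_eq_piAntidiag (d k : ℕ) :
    Finset.Nat.antidiagonalTuple d k = Finset.piAntidiag Finset.univ k := by
  ext f
  simp [Finset.Nat.mem_antidiagonalTuple, Finset.mem_piAntidiag]

lemma multinomial_term_algebra {t₀ t₁ t₂ u₀ u₁ u₂ F₀ F₁ F₂ F₃ K : ℂ} (hK : K ≠ 0)
    (k₀ k₁ k₂ k₃ : ℕ) :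
    (-2 : ℂ) ^ k₃ / F₃ * (t₀ ^ (2 * k₀ + k₃) / F₀ * u₀ ^ (k₁ + k₂ + k₃) *
      (t₁ ^ (2 * k₁ + k₃) / F₁ * u₁ ^ (k₀ + k₂ + k₃)) *
      (t₂ ^ (2 * k₂ + k₃) / F₂ * u₂ ^ (k₀ + k₁ + k₃))) =
    K / (F₀ * F₁ * F₂ * F₃) * ((t₀ ^ 2 * u₁ * u₂) ^ k₀ * (t₁ ^ 2 * u₂ * u₀) ^ k₁ *
      (t₂ ^ 2 * u₀ * u₁) ^ k₂ * (-2 * (t₀ * u₀ * (t₁ * u₁) * (t₂ * u₂))) ^ k₃) / K := by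
  have aux : ∀ X Y : ℂ, K / X * Y / K = Y / X := fun X Y => by field_simp
  rw [aux]
  generalize (-2 : ℂ) = e
  simp only [mul_pow, pow_add, pow_mul, div_eq_mul_inv, mul_inv]
  ring

/-- Multinomial theorem for the four monomials of `corrPoly`. The variable `u j` is missing only
from the monomial counted by `κ j`, hence its exponent `k - κ j`. -/
lemma sum_antidiagonalTuple_eq_corrPoly_pow (Θ : Matrix (Fin 3) (Fin 3) ℝ) (u : Fin 3 → ℂ)
    (k : ℕ) :
    ∑ κ ∈ Finset.Nat.antidiagonalTuple 4 k, ((-2 : ℂ) ^ κ 3 / ((κ 3)! : ℂ)) *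
      ∏ j : Fin 3, ((oppositeCorr Θ j : ℂ) ^ (2 * κ j.castSucc + κ 3) / ((κ j.castSucc)! : ℂ) *
        u j ^ (k - κ j.castSucc)) = corrPoly Θ u ^ k / k ! := by
  set f : Fin 4 → ℂ := ![(oppositeCorr Θ 0 : ℂ) ^ 2 * u 1 * u 2,
    (oppositeCorr Θ 1 : ℂ) ^ 2 * u 2 * u 0, (oppositeCorr Θ 2 : ℂ) ^ 2 * u 0 * u 1,
    -2 * ((oppositeCorr Θ 0 : ℂ) * u 0 *
        ((oppositeCorr Θ 1 : ℂ) * u 1) * ((oppositeCorr Θ 2 : ℂ) * u 2))] with hf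
  have hP : corrPoly Θ u = ∑ i, f i := by
    rw [corrPoly_eq]; simp [hf, Fin.sum_univ_four]; ring
  rw [hP, Finset.sum_pow_eq_sum_piAntidiag, antidiagonalTuple_eq_piAntidiag, Finset.sum_div]
  refine Finset.sum_congr rfl fun κ hκ => ?_
  have hs : κ 0 + κ 1 + κ 2 + κ 3 = k := by
    have := (Finset.mem_piAntidiag.1 hκ).1
    rwa [Fin.sum_univ_four] at this
  have hm := Nat.multinomial_spec Finset.univ κ
  rw [Fin.sum_univ_four, Fin.prod_univ_four, hs] at hm
  have hm' : (((κ 0)! * (κ 1)! * (κ 2)! * (κ 3)! : ℕ) : ℂ) *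
      (Nat.multinomial Finset.univ κ : ℂ) = (k ! : ℂ) := by exact_mod_cast hm
  have e0 : k - κ 0 = κ 1 + κ 2 + κ 3 := by omega
  have e1 : k - κ 1 = κ 0 + κ 2 + κ 3 := by omega
  have e2 : k - κ 2 = κ 0 + κ 1 + κ 3 := by omega
  have hk : (k ! : ℂ) ≠ 0 := by exact_mod_cast Nat.factorial_ne_zero _
  rw [Fin.prod_univ_three, Fin.prod_univ_four]
  have c0 : (Fin.castSucc 0 : Fin 4) = 0 := rfl
  have c1 : (Fin.castSucc 1 : Fin 4) = 1 := rfl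
  have c2 : (Fin.castSucc 2 : Fin 4) = 2 := rfl
  have hmu : (Nat.multinomial Finset.univ κ : ℂ) =
      (k ! : ℂ) / ((κ 0)! * (κ 1)! * (κ 2)! * (κ 3)!) := by
    rw [eq_div_iff (by simp [Nat.factorial_ne_zero]), ← hm']; push_cast; ring
  simp only [c0, c1, c2, e0, e1, e2, hmu, hf, Matrix.cons_val_zero, Matrix.cons_val_one,
    Matrix.cons_val]
  exact multinomial_term_algebra hk _ _ _ _

section Term

variable {n : Fin 3 → ℕ} {α : ℝ} {Θ : Matrix (Fin 3) (Fin 3) ℝ} {a : (j : Fin 3) → Fin (n j) → ℝ}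

lemma gammaSeriesTerm_eq (x : ((j : Fin 3) × Fin (n j)) → ℝ) (k : ℕ) :
    gammaSeriesTerm α Θ a x k = ∑ κ ∈ Finset.Nat.antidiagonalTuple 4 k,
      ((ascPochhammer ℝ k).eval α * ((-2 : ℝ) ^ κ 3 / ((κ 3)! : ℝ)) *
      ∏ j : Fin 3, (oppositeCorr Θ j ^ (2 * κ j.castSucc + κ 3) / ((κ j.castSucc)! : ℝ))) *
        ∏ j : Fin 3, laguerreCoeff (k - κ j.castSucc) (fun i => x ⟨j, i⟩) α (a j) := by
  rw [gammaSeriesTerm]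
  refine Finset.sum_congr rfl fun κ _ => ?_
  rw [Finset.prod_mul_distrib, mul_assoc, mul_assoc, mul_assoc]

lemma continuous_gammaSeriesTerm (hα : 0 < α) (ha : ∀ j i, 0 < a j i ∧ a j i < 1) (k : ℕ) :
    Continuous fun x => gammaSeriesTerm α Θ a x k := by
  simp_rw [gammaSeriesTerm_eq]
  refine continuous_finsetSum _ fun κ _ => continuous_const.mul
    (continuous_finsetProd _ fun j _ => ?_)
  exact (continuous_laguerreCoeff _ hα (ha j)).comp (by fun_prop)

lemma gammaSeriesTerm_of_nonpos (hα : 0 < α) (ha : ∀ j i, 0 < a j i ∧ a j i < 1) (k : ℕ)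
    {x : ((j : Fin 3) × Fin (n j)) → ℝ} {u : (j : Fin 3) × Fin (n j)} (hx : x u ≤ 0) :
    gammaSeriesTerm α Θ a x k = 0 := by
  rw [gammaSeriesTerm_eq]
  refine Finset.sum_eq_zero fun κ _ => mul_eq_zero_of_right _
    (Finset.prod_eq_zero (Finset.mem_univ u.1) ?_)
  exact laguerreCoeff_of_nonpos _ hα (ha u.1) (i := u.2) hx

lemma exists_norm_gammaSeriesTerm_le (hα : 0 < α) (ha : ∀ j i, 0 < a j i ∧ a j i < 1) (k : ℕ) :
    ∃ C, ∀ x, ‖gammaSeriesTerm α Θ a x k‖ ≤ C := by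
  choose C hC using fun (m : ℕ) (j : Fin 3) => exists_norm_laguerreCoeff_le m hα (ha j)
  simp_rw [gammaSeriesTerm_eq]
  refine ⟨∑ κ ∈ Finset.Nat.antidiagonalTuple 4 k,
    ‖(ascPochhammer ℝ k).eval α * ((-2 : ℝ) ^ κ 3 / ((κ 3)! : ℝ)) *
      ∏ j : Fin 3, (oppositeCorr Θ j ^ (2 * κ j.castSucc + κ 3) / ((κ j.castSucc)! : ℝ))‖ * ∏ j : Fin 3, C (k - κ j.castSucc) j,
    fun x => (norm_sum_le _ _).trans (Finset.sum_le_sum fun κ _ => ?_)⟩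
  rw [norm_mul]
  refine mul_le_mul_of_nonneg_left ?_ (norm_nonneg _)
  rw [norm_prod]
  exact Finset.prod_le_prod (fun _ _ => norm_nonneg _) fun j _ => hC _ _ _

end Term

/-! ### Functions supported on the orthant -/

section Orthant

variable {ι : Type*} [Fintype ι]

/-- The vector `c` is an admissible growth rate: `0` suffices for the cdf and for a single term,
while the bounds summable in `k` have rate `1`, which later forces `1 < t u`. -/
lemma norm_exp_mul_le_of_bounded_orthant {f : (ι → ℝ) → ℝ}
    (h0 : ∀ x u, x u < 0 → f x = 0) {C : ℝ} {c : ι → ℝ}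
    (hC : ∀ x, ‖f x‖ ≤ C * Real.exp (∑ u, c u * x u)) (s : ι → ℂ) (x : ι → ℝ) :
    ‖(∏ u, Complex.exp (-(s u * x u))) * (f x : ℂ)‖ ≤
      C * ∏ u, (Ici (0 : ℝ)).indicator (fun x => Real.exp (-(((s u).re - c u) * x))) (x u) := by
  by_cases hx : ∀ u, 0 ≤ x u
  · simp only [norm_mul, norm_prod, norm_exp_neg_mul_ofReal, Complex.norm_real, indicator, mem_Ici,
      hx, if_true]
    refine (mul_le_mul_of_nonneg_left (hC x) (Finset.prod_nonneg fun _ _ =>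
      (Real.exp_pos _).le)).trans_eq ?_
    rw [Real.exp_sum, mul_left_comm, ← Finset.prod_mul_distrib]
    congr 1
    refine Finset.prod_congr rfl fun u _ => ?_
    rw [← Real.exp_add]; congr 1; ring
  · push Not at hx
    obtain ⟨u, hu⟩ := hx
    have : ∏ u, (Ici (0 : ℝ)).indicator (fun x => Real.exp (-(((s u).re - c u) * x))) (x u) = 0 :=
      Finset.prod_eq_zero (Finset.mem_univ u) (by simp [hu])
    rw [h0 x u hu, this]; simp

lemma integrable_prod_indicator_exp {c : ι → ℝ} {s : ι → ℂ} (hs : ∀ u, c u < (s u).re) :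
    Integrable (fun x : ι → ℝ =>
      ∏ u, (Ici (0 : ℝ)).indicator (fun x => Real.exp (-(((s u).re - c u) * x))) (x u)) :=
  Integrable.fintype_prod (f := fun u =>
      (Ici (0 : ℝ)).indicator (fun x => Real.exp (-(((s u).re - c u) * x))))
      fun u => integrable_indicator_exp_neg_mul (sub_pos.2 (hs u))

lemma integrable_exp_mul_of_bounded_orthant {f : (ι → ℝ) → ℝ} (hf : Measurable f)
    (h0 : ∀ x u, x u < 0 → f x = 0) {C : ℝ} {c : ι → ℝ}
    (hC : ∀ x, ‖f x‖ ≤ C * Real.exp (∑ u, c u * x u))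
    {s : ι → ℂ} (hs : ∀ u, c u < (s u).re) :
    Integrable (fun x : ι → ℝ => (∏ u, Complex.exp (-(s u * x u))) * (f x : ℂ)) :=
  ((integrable_prod_indicator_exp hs).const_mul C).mono'
    (Measurable.aestronglyMeasurable (by fun_prop))
    (ae_of_all _ (norm_exp_mul_le_of_bounded_orthant h0 hC s))

end Orthant

/-! ### The Laplace transform of one term of the series -/

section Term

variable {n : Fin 3 → ℕ} {α : ℝ} {Θ : Matrix (Fin 3) (Fin 3) ℝ} {a : (j : Fin 3) → Fin (n j) → ℝ}

/-- The prefactor is the same for every decomposition `κ`, so the inner sum acts only on powers of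
the block ratios and closes up to a power of `corrPoly`. -/
lemma integral_exp_mul_gammaSeriesTerm (hα : 0 < α) (ha : ∀ j i, 0 < a j i ∧ a j i < 1) (k : ℕ)
    {s : ((j : Fin 3) × Fin (n j)) → ℂ} (hs : ∀ u, 0 < (s u).re) :
    ∫ x : ((j : Fin 3) × Fin (n j)) → ℝ, (∏ u, Complex.exp (-(s u * x u))) *
      (gammaSeriesTerm α Θ a x k : ℂ) =
    ((∏ u, (s u)⁻¹ * (1 + ((1 - a u.1 u.2 ^ 2 : ℝ) : ℂ) * s u) ^ (-(α : ℂ))) *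
      ∏ j, (1 + blockShift (a j) (fun i => s ⟨j, i⟩)) ^ (-(α : ℂ))) *
      (((ascPochhammer ℝ k).eval α / k ! : ℝ) *
        corrPoly Θ (fun j => blockRatio (a j) (fun i => s ⟨j, i⟩)) ^ k) := by
  have hint : ∀ m : Fin 3 → ℕ, Integrable (fun x : ((j : Fin 3) × Fin (n j)) → ℝ =>
      (∏ u, Complex.exp (-(s u * x u))) *
        ((∏ j, laguerreCoeff (m j) (fun i => x ⟨j, i⟩) α (a j) : ℝ) : ℂ)) := by
    intro m
    choose C hC using fun (m : ℕ) (j : Fin 3) => exists_norm_laguerreCoeff_le m hα (ha j)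
    refine integrable_exp_mul_of_bounded_orthant (c := 0) (C := ∏ j, C (m j) j)
      (Continuous.measurable (continuous_finsetProd _ fun j _ =>
        (continuous_laguerreCoeff _ hα (ha j)).comp (by fun_prop))) ?_ ?_ hs
    · intro x u hu
      exact Finset.prod_eq_zero (Finset.mem_univ u.1)
        (laguerreCoeff_of_nonpos _ hα (ha u.1) (i := u.2) hu.le)
    · intro x
      simp only [Pi.zero_apply, zero_mul, Finset.sum_const_zero, Real.exp_zero, mul_one, norm_prod]
      exact Finset.prod_le_prod (fun _ _ => norm_nonneg _) fun j _ => hC _ _ _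
  have h1 : ∀ x : ((j : Fin 3) × Fin (n j)) → ℝ, (∏ u, Complex.exp (-(s u * x u))) *
      (gammaSeriesTerm α Θ a x k : ℂ) = ∑ κ ∈ Finset.Nat.antidiagonalTuple 4 k,
      (((ascPochhammer ℝ k).eval α * ((-2 : ℝ) ^ κ 3 / ((κ 3)! : ℝ)) *
      ∏ j : Fin 3, (oppositeCorr Θ j ^ (2 * κ j.castSucc + κ 3) / ((κ j.castSucc)! : ℝ)) : ℝ) : ℂ) *
      ((∏ u, Complex.exp (-(s u * x u))) * ((∏ j : Fin 3,
        laguerreCoeff (k - κ j.castSucc) (fun i => x ⟨j, i⟩) α (a j) : ℝ) : ℂ)) := by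
    intro x
    rw [gammaSeriesTerm_eq, Complex.ofReal_sum, Finset.mul_sum]
    refine Finset.sum_congr rfl fun κ _ => ?_
    rw [Complex.ofReal_mul, mul_left_comm]
  simp_rw [h1]
  rw [integral_finsetSum _ fun κ _ => (hint fun j => k - κ j.castSucc).const_mul _]
  simp_rw [integral_const_mul]
  have h2 : ∀ κ : Fin 4 → ℕ, _ := fun κ =>
    integral_exp_mul_prod_laguerreCoeff hα ha (fun j => k - κ j.castSucc) hs
  simp_rw [h2]
  rw [Complex.ofReal_div, div_mul_eq_mul_div, mul_div_assoc, Complex.ofReal_natCast,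
    ← sum_antidiagonalTuple_eq_corrPoly_pow, Finset.mul_sum, Finset.mul_sum]
  refine Finset.sum_congr rfl fun κ _ => ?_
  simp only [Finset.prod_mul_distrib]
  push_cast
  ring

end Term

/-! ### A pointwise bound from the Laplace transform on a vertical line -/

/-- The values on the line `re s = 1` are the Fourier transform of `e^{-∑ x} f`. An integrable
majorant permits Fourier inversion, which bounds this function by `∫ B`; removing the damping costs
`e^{∑ x}`. -/
lemma norm_le_of_norm_laplace_le {ι : Type*} [Fintype ι] {f : (ι → ℝ) → ℝ} (hf : Continuous f)
    (hint : Integrable (fun x : ι → ℝ => (∏ u, Complex.exp (-((1 : ℂ) * x u))) * (f x : ℂ)))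
    {B : (ι → ℝ) → ℝ} (hB : Integrable B)
    (hfB : ∀ w : ι → ℝ, ‖∫ x : ι → ℝ, (∏ u, Complex.exp
      (-((1 + ((2 * Real.pi * w u : ℝ) : ℂ) * Complex.I) * x u))) * (f x : ℂ)‖ ≤ B w)
    (x : ι → ℝ) : ‖f x‖ ≤ (∫ w, B w) * Real.exp (∑ u, 1 * x u) := by
  set g : EuclideanSpace ℝ ι → ℂ :=
    fun v => (∏ u, Complex.exp (-((1 : ℂ) * v u))) * (f (WithLp.ofLp v) : ℂ) with hg
  have hmp := EuclideanSpace.volume_preserving_symm_measurableEquiv_toLp ι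
  have hgi : Integrable g := hmp.integrable_comp_of_integrable hint
  have hgc : Continuous g := by
    simp only [hg]
    have : Continuous fun v : EuclideanSpace ℝ ι => f (WithLp.ofLp v) :=
      hf.comp (PiLp.continuous_ofLp 2 _)
    fun_prop
  have hF : ∀ w : EuclideanSpace ℝ ι, FourierTransform.fourier g w = ∫ x : ι → ℝ,
      (∏ u, Complex.exp (-((1 + ((2 * Real.pi * w u : ℝ) : ℂ) * Complex.I) * x u))) *
        (f x : ℂ) := by
    intro w
    rw [Real.fourier_eq', ← hmp.integral_comp' (g := fun x : ι → ℝ =>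
      (∏ u, Complex.exp (-((1 + ((2 * Real.pi * w u : ℝ) : ℂ) * Complex.I) * x u))) * (f x : ℂ))]
    refine integral_congr_ae (ae_of_all _ fun v => ?_)
    simp only [hg, smul_eq_mul, ← mul_assoc]
    congr 1
    rw [← Complex.exp_sum, ← Complex.exp_add, ← Complex.exp_sum]
    congr 1
    rw [PiLp.inner_apply]
    push_cast
    rw [Finset.mul_sum, Finset.sum_mul, ← Finset.sum_add_distrib]
    refine Finset.sum_congr rfl fun u _ => ?_
    simp
    ring
  have hFc : Continuous (FourierTransform.fourier g) :=
    VectorFourier.fourierIntegral_continuous Real.continuous_fourierChar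
      (by exact continuous_inner) hgi
  have hBi : Integrable (fun w : EuclideanSpace ℝ ι => B (WithLp.ofLp w)) :=
    hmp.integrable_comp_of_integrable hB
  have hFB : ∀ w : EuclideanSpace ℝ ι, ‖FourierTransform.fourier g w‖ ≤ B (WithLp.ofLp w) :=
    fun w => by rw [hF]; exact hfB _
  have hFi : Integrable (FourierTransform.fourier g) :=
    hBi.mono' hFc.aestronglyMeasurable (ae_of_all _ hFB)
  have hinv := congrFun (hgc.fourierInv_fourier_eq hgi hFi) (WithLp.toLp 2 x)
  have hle : ‖g (WithLp.toLp 2 x)‖ ≤ ∫ w, B w := by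
    rw [← hinv, Real.fourierInv_eq']
    have : ∫ w, B w = ∫ w : EuclideanSpace ℝ ι, B (WithLp.ofLp w) := by
      rw [← hmp.integral_comp']; rfl
    rw [this]
    refine norm_integral_le_of_norm_le hBi (ae_of_all _ fun w => ?_)
    rw [norm_smul, Complex.norm_exp_ofReal_mul_I, one_mul]
    exact hFB w
  have hgx : ‖g (WithLp.toLp 2 x)‖ = Real.exp (-∑ u, 1 * x u) * ‖f x‖ := by
    simp only [hg, norm_mul, norm_prod, norm_exp_neg_mul_ofReal, Complex.norm_real,
      ← Real.exp_sum, Finset.sum_neg_distrib, Complex.one_re]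
  rw [hgx, Real.exp_neg, inv_mul_le_iff₀ (Real.exp_pos _), mul_comm] at hle
  exact hle

/-! ### Bounds on the vertical line `re s = 1` -/

lemma half_le_norm_one_add_mul_I (t : ℝ) :
    (1 + |t|) / 2 ≤ ‖(1 + ((2 * Real.pi * t : ℝ) : ℂ) * Complex.I)‖ := by
  have h1 := Complex.abs_re_le_norm (1 + ((2 * Real.pi * t : ℝ) : ℂ) * Complex.I)
  have h2 := Complex.abs_im_le_norm (1 + ((2 * Real.pi * t : ℝ) : ℂ) * Complex.I)
  have e1 : (1 + ((2 * Real.pi * t : ℝ) : ℂ) * Complex.I).re = 1 := by simp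
  have e2 : (1 + ((2 * Real.pi * t : ℝ) : ℂ) * Complex.I).im = 2 * Real.pi * t := by simp
  rw [e1, abs_one] at h1
  rw [e2, abs_mul, abs_of_pos (by positivity)] at h2
  nlinarith [Real.pi_gt_three, abs_nonneg t]

lemma mul_norm_le_norm_one_add_mul {b : ℝ} (hb : 0 < b) {s : ℂ} (hs : 0 ≤ s.re) :
    b * ‖s‖ ≤ ‖1 + b * s‖ := by
  have h : b * ‖s‖ = ‖(b : ℂ) * s‖ := by
    rw [norm_mul, Complex.norm_real, Real.norm_of_nonneg hb.le]
  rw [h, ← sq_le_sq₀ (norm_nonneg _) (norm_nonneg _), Complex.sq_norm, Complex.sq_norm,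
    Complex.normSq_apply, Complex.normSq_apply]
  simp only [Complex.add_re, Complex.one_re, Complex.add_im, Complex.one_im, zero_add,
    Complex.re_ofReal_mul]
  nlinarith [mul_nonneg hb.le hs]

/-- The power alone decays like `|t|^{-α}`, which need not be integrable; the factor `s⁻¹` that
comes with distribution functions raises the exponent to `1 + α > 1`. -/
lemma norm_marginal_factor_le {α b : ℝ} (hα : 0 < α) (hb : 0 < b) (t : ℝ) :
    ‖(1 + ((2 * Real.pi * t : ℝ) : ℂ) * Complex.I)⁻¹ *
      (1 + b * (1 + ((2 * Real.pi * t : ℝ) : ℂ) * Complex.I)) ^ (-(α : ℂ))‖ ≤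
      (2 * (b / 2) ^ (-α)) * (1 + ‖t‖) ^ (-(1 + α)) := by
  set s : ℂ := 1 + ((2 * Real.pi * t : ℝ) : ℂ) * Complex.I with hs
  have h1 := half_le_norm_one_add_mul_I t
  rw [← hs] at h1
  have ht : 0 < 1 + |t| := by positivity
  have h2 := mul_norm_le_norm_one_add_mul hb (s := s) (by simp [hs])
  rw [norm_mul, norm_inv, ← Complex.ofReal_neg, Complex.norm_cpow_real]
  have h3 : ‖s‖⁻¹ ≤ 2 * (1 + |t|)⁻¹ := by
    rw [← div_eq_mul_inv, ← inv_div]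
    exact inv_anti₀ (by positivity) h1
  have h4 : ‖1 + b * s‖ ^ (-α) ≤ (b / 2) ^ (-α) * (1 + |t|) ^ (-α) := by
    rw [← Real.mul_rpow (by positivity) ht.le]
    refine Real.rpow_le_rpow_of_nonpos (by positivity) ?_ (by linarith)
    refine le_trans ?_ h2
    nlinarith
  refine (mul_le_mul h3 h4 (by positivity) (by positivity)).trans_eq ?_
  rw [Real.norm_eq_abs, neg_add, Real.rpow_add ht, Real.rpow_neg_one]
  ring

lemma integrable_marginal_bound {α : ℝ} (hα : 0 < α) (c : ℝ) :
    Integrable fun t : ℝ => c * (1 + ‖t‖) ^ (-(1 + α)) :=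
  (integrable_one_add_norm (by simpa using hα)).const_mul _

lemma norm_one_add_cpow_neg_le_one {α : ℝ} (hα : 0 < α) {z : ℂ} (hz : 0 ≤ z.re) :
    ‖(1 + z) ^ (-(α : ℂ))‖ ≤ 1 := by
  rw [← Complex.ofReal_neg, Complex.norm_cpow_real]
  refine Real.rpow_le_one_of_one_le_of_nonpos ?_ (by linarith)
  have := Complex.re_le_norm (1 + z)
  simp only [Complex.add_re, Complex.one_re] at this
  linarith

/-! ### The disc condition -/

/-- The Möbius map `s ↦ s / (1 + b s)` sends the right half-plane into the disc with diameter `[0,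
b⁻¹]`. After clearing denominators, the slack is `b⁻¹ · re s`. -/
lemma normSq_div_one_add_le {b : ℝ} (hb : 0 < b) {s : ℂ} (hs : 0 < s.re) :
    Complex.normSq (s / (1 + b * s)) ≤ b⁻¹ * (s / (1 + b * s)).re := by
  have h0 : 1 + (b : ℂ) * s ≠ 0 := one_add_ne_zero_of_re_nonneg (by simpa using (mul_pos hb hs).le)
  have h1 : 0 < Complex.normSq (1 + b * s) := Complex.normSq_pos.2 h0
  rw [Complex.normSq_div, Complex.div_re, ← add_div, ← mul_div_assoc, div_le_div_iff_of_pos_right h1,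
    le_inv_mul_iff₀ hb]
  simp only [Complex.add_re, Complex.one_re, Complex.add_im, Complex.one_im, zero_add,
    Complex.re_ofReal_mul, Complex.im_ofReal_mul, Complex.normSq_apply]
  nlinarith

/-- `|z - p/2| ≤ p/2`, written without square roots. -/
lemma norm_sub_half_le_iff {p : ℝ} (hp : 0 ≤ p) (z : ℂ) :
    ‖z - ((p / 2 : ℝ) : ℂ)‖ ≤ p / 2 ↔ Complex.normSq z ≤ p * z.re := by
  rw [← sq_le_sq₀ (norm_nonneg _) (by positivity), Complex.sq_norm, Complex.normSq_apply,
    Complex.normSq_apply]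
  simp only [Complex.sub_re, Complex.sub_im, Complex.ofReal_re, Complex.ofReal_im, sub_zero]
  constructor <;> intro h <;> nlinarith

/-- `p = ∑ a_μ² / (1 - a_μ²)`. -/
noncomputable def blockWeight {m : ℕ} (a : Fin m → ℝ) : ℝ := ∑ i, a i ^ 2 / (1 - a i ^ 2)

lemma blockWeight_nonneg {m : ℕ} {a : Fin m → ℝ} (ha : ∀ i, 0 < a i ∧ a i < 1) :
    0 ≤ blockWeight a :=
  Finset.sum_nonneg fun i _ => div_nonneg (sq_nonneg _) (one_sub_sq_pos (ha i)).le

lemma blockRadius_eq {m : ℕ} (a : Fin m → ℝ) :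
    blockRadius a = blockWeight a / (1 + blockWeight a) := rfl

lemma blockRadius_nonneg {m : ℕ} {a : Fin m → ℝ} (ha : ∀ i, 0 < a i ∧ a i < 1) :
    0 ≤ blockRadius a := by
  have := blockWeight_nonneg ha
  rw [blockRadius_eq]; positivity

lemma blockRadius_lt_one {m : ℕ} {a : Fin m → ℝ} (ha : ∀ i, 0 < a i ∧ a i < 1) :
    blockRadius a < 1 := by
  have := blockWeight_nonneg ha
  rw [blockRadius_eq, div_lt_one (by positivity)]; linarith

/-- The summands lie in discs tangent to the imaginary axis at `0`. Under addition their centres and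
radii add, and the sum lies in the disc with diameter `[0, p]`. -/
lemma normSq_blockShift_le {m : ℕ} {a : Fin m → ℝ} (ha : ∀ i, 0 < a i ∧ a i < 1)
    {s : Fin m → ℂ} (hs : ∀ i, 0 < (s i).re) :
    Complex.normSq (blockShift a s) ≤ blockWeight a * (blockShift a s).re := by
  rw [← norm_sub_half_le_iff (blockWeight_nonneg ha), blockShift, blockWeight, Finset.sum_div,
    Complex.ofReal_sum, ← Finset.sum_sub_distrib]
  refine (norm_sum_le _ _).trans (Finset.sum_le_sum fun i _ => ?_)
  have hb := one_sub_sq_pos (ha i)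
  rw [norm_sub_half_le_iff (div_nonneg (sq_nonneg _) hb.le), Complex.normSq_mul,
    ← Complex.ofReal_pow, Complex.re_ofReal_mul, Complex.normSq_ofReal]
  have := normSq_div_one_add_le hb (hs i)
  calc a i ^ 2 * a i ^ 2 * _ ≤ a i ^ 2 * a i ^ 2 * _ :=
        mul_le_mul_of_nonneg_left this (by positivity)
    _ = _ := by ring

/-- The map `z ↦ z / (1 + z)` commutes with conjugation and sends `0` and `p` to `0` and `d = p / (1
+ p)`, so the disc with diameter `[0, p]` goes to the one with diameter `[0, d]`. -/
lemma normSq_blockRatio_le {m : ℕ} {a : Fin m → ℝ} (ha : ∀ i, 0 < a i ∧ a i < 1)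
    {s : Fin m → ℂ} (hs : ∀ i, 0 < (s i).re) :
    Complex.normSq (blockRatio a s) ≤ blockRadius a * (blockRatio a s).re := by
  have hz := blockShift_re_nonneg ha hs
  have h := normSq_blockShift_le ha hs
  have hp := blockWeight_nonneg ha
  rw [blockRatio, blockRadius_eq]
  generalize blockShift a s = z at *
  generalize blockWeight a = p at *
  have h1 : 0 < Complex.normSq (1 + z) := Complex.normSq_pos.2 (one_add_ne_zero_of_re_nonneg hz)
  have hp1 : 0 < 1 + p := by positivity
  rw [Complex.normSq_div, Complex.div_re, ← add_div, ← mul_div_assoc,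
    div_le_div_iff_of_pos_right h1, div_mul_eq_mul_div, le_div_iff₀ hp1]
  simp only [Complex.add_re, Complex.one_re, Complex.add_im, Complex.one_im, zero_add,
    Complex.normSq_apply] at *
  nlinarith

/-! ### Maximum over the polydisc -/

/-- In polar form the equation of the circle reads `‖z‖ = d cos (arg z)`, so `γ = arg z`. The point
`0` is reached at `γ = π/2`, where the cosine vanishes. -/
lemma circlePoint_eq_of_mem_circle {m : ℕ} (a : Fin m → ℝ) (hd : 0 ≤ blockRadius a) {z : ℂ}
    (hz : Complex.normSq z = blockRadius a * z.re) :
    ∃ γ ∈ Icc (-(Real.pi / 2)) (Real.pi / 2), circlePoint a γ = z := by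
  by_cases h0 : z = 0
  · refine ⟨Real.pi / 2, ⟨by linarith [Real.pi_pos], le_rfl⟩, ?_⟩
    simp [circlePoint, h0]
  · have hpos : 0 < Complex.normSq z := Complex.normSq_pos.2 h0
    have hd0 : 0 < blockRadius a := by
      rcases hd.lt_or_eq with h | h
      · exact h
      · rw [← h, zero_mul] at hz; exact absurd hz hpos.ne'
    have hre : 0 < z.re := by
      by_contra h
      nlinarith [mul_nonneg hd0.le (neg_nonneg.2 (not_lt.1 h))]
    refine ⟨Complex.arg z, abs_le.1 (Complex.abs_arg_le_pi_div_two_iff.2 hre.le), ?_⟩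
    rw [circlePoint]
    have h1 : Real.cos (Complex.arg z) = z.re / ‖z‖ := Complex.cos_arg h0
    have hn : 0 < ‖z‖ := norm_pos_iff.2 h0
    have h2 : blockRadius a * Real.cos (Complex.arg z) = ‖z‖ := by
      rw [h1, ← mul_div_assoc, ← hz, Complex.normSq_eq_norm_sq, sq, mul_div_assoc, div_self hn.ne',
        mul_one]
    rw [← Complex.ofReal_mul, h2, mul_comm Complex.I]
    exact Complex.norm_mul_exp_arg_mul_I z

/-- An affine function is bounded on a disc by its bound on the boundary circle. -/
lemma norm_affine_le_of_disc {d q : ℝ} {A B : ℂ}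
    (h : ∀ z : ℂ, Complex.normSq z = d * z.re → ‖A * z + B‖ ≤ q) {u : ℂ}
    (hu : Complex.normSq u ≤ d * u.re) : ‖A * u + B‖ ≤ q := by
  -- `r` is half the vertical chord through `u`; its endpoints lie on the circle and `u` is a convex
  -- combination of them.
  set r : ℝ := Real.sqrt (d * u.re - u.re ^ 2) with hr
  rw [Complex.normSq_apply] at hu
  have hr2 : r ^ 2 = d * u.re - u.re ^ 2 := Real.sq_sqrt (by nlinarith [sq_nonneg u.im])
  have hr0 : 0 ≤ r := Real.sqrt_nonneg _
  have him : |u.im| ≤ r := abs_le_of_sq_le_sq (by nlinarith) hr0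
  obtain ⟨him1, him2⟩ := abs_le.1 him
  have hv : ∀ t : ℝ, t ^ 2 = r ^ 2 → ‖A * (⟨u.re, t⟩ : ℂ) + B‖ ≤ q := by
    intro t ht
    refine h _ ?_
    rw [Complex.normSq_apply]
    simp only
    nlinarith
  have h1 := hv r rfl
  have h2 := hv (-r) (by ring)
  rcases hr0.lt_or_eq with hr1 | hr1
  · set l : ℝ := (r + u.im) / (2 * r) with hl
    have hl0 : 0 ≤ l := div_nonneg (by linarith) (by linarith)
    have hl1 : 0 ≤ 1 - l := by
      rw [sub_nonneg, hl, div_le_one (by linarith)]; linarith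
    have hsplit : A * u + B = (l : ℂ) * (A * (⟨u.re, r⟩ : ℂ) + B) +
        ((1 - l : ℝ) : ℂ) * (A * (⟨u.re, -r⟩ : ℂ) + B) := by
      have : u = (l : ℂ) * (⟨u.re, r⟩ : ℂ) + ((1 - l : ℝ) : ℂ) * (⟨u.re, -r⟩ : ℂ) := by
        have hlr : l * (2 * r) = r + u.im := by rw [hl]; field_simp
        apply Complex.ext
        · simp only [Complex.add_re, Complex.re_ofReal_mul]; ring
        · simp only [Complex.add_im, Complex.im_ofReal_mul]; linarith
      conv_lhs => rw [this]
      push_cast; ring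
    rw [hsplit]
    refine (norm_add_le _ _).trans ?_
    rw [norm_mul, norm_mul, Complex.norm_real, Complex.norm_real, Real.norm_of_nonneg hl0,
      Real.norm_of_nonneg hl1]
    nlinarith
  · have : u = ⟨u.re, r⟩ := by
      apply Complex.ext <;> simp
      linarith
    rw [this]; exact h1

/-- `corrPoly` is affine in each variable separately, so the bound passes from circle to disc one
variable at a time. -/
lemma norm_corrPoly_le_of_polydisc {Θ : Matrix (Fin 3) (Fin 3) ℝ} {d : Fin 3 → ℝ} {q : ℝ}
    (h : ∀ z : Fin 3 → ℂ, (∀ j, Complex.normSq (z j) = d j * (z j).re) → ‖corrPoly Θ z‖ ≤ q)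
    {u : Fin 3 → ℂ} (hu : ∀ j, Complex.normSq (u j) ≤ d j * (u j).re) : ‖corrPoly Θ u‖ ≤ q := by
  set t₀ : ℂ := (oppositeCorr Θ 0 : ℂ)
  set t₁ : ℂ := (oppositeCorr Θ 1 : ℂ)
  set t₂ : ℂ := (oppositeCorr Θ 2 : ℂ)
  have hP : ∀ x y z : ℂ, corrPoly Θ ![x, y, z] = t₀ ^ 2 * y * z + t₁ ^ 2 * z * x +
      t₂ ^ 2 * x * y - 2 * (t₀ * x * (t₁ * y) * (t₂ * z)) := fun x y z => by
    rw [corrPoly_eq]; rfl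
  have e0 : ∀ x y z : ℂ, corrPoly Θ ![x, y, z] =
      (t₁ ^ 2 * z + t₂ ^ 2 * y - 2 * t₀ * t₁ * t₂ * y * z) * x + t₀ ^ 2 * y * z :=
    fun x y z => by rw [hP]; ring
  have e1 : ∀ x y z : ℂ, corrPoly Θ ![x, y, z] =
      (t₀ ^ 2 * z + t₂ ^ 2 * x - 2 * t₀ * t₁ * t₂ * x * z) * y + t₁ ^ 2 * z * x :=
    fun x y z => by rw [hP]; ring
  have e2 : ∀ x y z : ℂ, corrPoly Θ ![x, y, z] =
      (t₀ ^ 2 * y + t₁ ^ 2 * x - 2 * t₀ * t₁ * t₂ * x * y) * z + t₂ ^ 2 * x * y :=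
    fun x y z => by rw [hP]; ring
  have hu3 : u = ![u 0, u 1, u 2] := by ext j; fin_cases j <;> rfl
  rw [hu3, e0]
  refine norm_affine_le_of_disc (fun x hx => ?_) (hu 0)
  rw [← e0, e1]
  refine norm_affine_le_of_disc (fun y hy => ?_) (hu 1)
  rw [← e1, e2]
  refine norm_affine_le_of_disc (fun z hz => ?_) (hu 2)
  rw [← e2]
  refine h _ fun j => ?_
  fin_cases j
  · exact hx
  · exact hy
  · exact hz

lemma MaxRhoSqLtOne.exists_norm_corrPoly_le {n : Fin 3 → ℕ} {Θ : Matrix (Fin 3) (Fin 3) ℝ}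
    {a : (j : Fin 3) → Fin (n j) → ℝ} (ha : ∀ j i, 0 < a j i ∧ a j i < 1)
    (h : MaxRhoSqLtOne Θ a) : ∃ q : ℝ, 0 ≤ q ∧ q < 1 ∧ ∀ u : Fin 3 → ℂ,
      (∀ j, Complex.normSq (u j) ≤ blockRadius (a j) * (u j).re) → ‖corrPoly Θ u‖ ≤ q := by
  obtain ⟨M, hM, hM1⟩ := h
  refine ⟨Real.sqrt M, Real.sqrt_nonneg _, ?_, fun u hu => ?_⟩
  · rw [Real.sqrt_lt' one_pos]; simpa using hM1
  · refine norm_corrPoly_le_of_polydisc (fun z hz => ?_) hu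
    choose γ hγ hγz using fun j => circlePoint_eq_of_mem_circle (a j)
      (blockRadius_nonneg (ha j)) (hz j)
    refine Real.le_sqrt_of_sq_le (hM.2 ⟨γ, hγ, ?_⟩)
    simp only [rhoSq, corrPoly, hγz]

/-! ### The Laplace transform of the multivariate gamma distribution -/

section Det

variable {p : ℕ} {n : Fin p → ℕ}

/-- The real counterpart of `blockShift`. -/
noncomputable def blockShiftReal {m : ℕ} (a t : Fin m → ℝ) : ℝ :=
  ∑ i, a i ^ 2 * (t i / (1 + (1 - a i ^ 2) * t i))

lemma blockShift_ofReal {m : ℕ} (a t : Fin m → ℝ) :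
    blockShift a (fun i => (t i : ℂ)) = (blockShiftReal a t : ℂ) := by
  simp [blockShift, blockShiftReal]

lemma blockShiftReal_nonneg {m : ℕ} {a t : Fin m → ℝ} (ha : ∀ i, 0 < a i ∧ a i < 1)
    (ht : ∀ i, 0 < t i) : 0 ≤ blockShiftReal a t :=
  Finset.sum_nonneg fun i _ => mul_nonneg (sq_nonneg _) (div_nonneg (ht i).le
    (by nlinarith [mul_pos (one_sub_sq_pos (ha i)) (ht i)]))

/-- The matrix factors as `(1 + A Θ B) · diag e` with `A` and `B` passing through `Fin p`. Moving
`A` to the other side by `det (1 + XY) = det (1 + YX)` leaves `B A`, which is diagonal with the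
block shifts as entries. -/
lemma det_one_add_blockCorrelation_mul_diagonal (Θ : Matrix (Fin p) (Fin p) ℝ)
    {a : (j : Fin p) → Fin (n j) → ℝ} (ha : ∀ j i, 0 < a j i ∧ a j i < 1)
    {t : ((j : Fin p) × Fin (n j)) → ℝ} (ht : ∀ u, 0 < t u) :
    (1 + blockCorrelation Θ a * Matrix.diagonal t).det =
      (∏ u, (1 + (1 - a u.1 u.2 ^ 2) * t u)) *
        (1 + Θ * Matrix.diagonal fun j => blockShiftReal (a j) fun i => t ⟨j, i⟩).det := by
  set e : ((j : Fin p) × Fin (n j)) → ℝ := fun u => 1 + (1 - a u.1 u.2 ^ 2) * t u with he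
  have he0 : ∀ u, e u ≠ 0 := fun u => by
    have := mul_pos (one_sub_sq_pos (ha u.1 u.2)) (ht u)
    simp only [he]; positivity
  set A : Matrix ((j : Fin p) × Fin (n j)) (Fin p) ℝ :=
    Matrix.of fun u j => if u.1 = j then a u.1 u.2 else 0 with hA
  set B : Matrix (Fin p) ((j : Fin p) × Fin (n j)) ℝ :=
    Matrix.of fun j u => if u.1 = j then a u.1 u.2 * (t u / e u) else 0 with hB
  have hAB : ∀ u v, (A * (Θ * B)) u v = a u.1 u.2 * (Θ u.1 v.1 * (a v.1 v.2 * (t v / e v))) := by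
    intro u v
    rw [Matrix.mul_apply, Finset.sum_eq_single u.1, Matrix.mul_apply, Finset.sum_eq_single v.1]
    · simp [hA, hB]
    · intro k _ hk; simp [hB, hk.symm]
    · simp
    · intro k _ hk; simp [hA, hk.symm]
    · simp
  have h1 : (1 + blockCorrelation Θ a * Matrix.diagonal t) =
      (1 + A * (Θ * B)) * Matrix.diagonal e := by
    ext u v
    rw [Matrix.add_apply, Matrix.mul_diagonal, Matrix.mul_diagonal, Matrix.add_apply, hAB,
      blockCorrelation, Matrix.add_apply, Matrix.of_apply]
    have := he0 v
    by_cases huv : u = v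
    · subst huv
      rw [Matrix.one_apply_eq, Matrix.diagonal_apply_eq]
      field_simp
      simp only [he]; ring
    · rw [Matrix.one_apply_ne huv, Matrix.diagonal_apply_ne _ huv]
      field_simp
      ring
  rw [h1, Matrix.det_mul, Matrix.det_diagonal, mul_comm]
  congr 1
  rw [Matrix.det_one_add_mul_comm, Matrix.mul_assoc]
  congr 3
  ext i j
  rw [Matrix.mul_apply, Fintype.sum_sigma]
  by_cases hij : i = j
  · subst hij
    rw [Matrix.diagonal_apply_eq, Finset.sum_eq_single i]
    · simp only [hA, hB, Matrix.of_apply, if_true, blockShiftReal, he]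
      exact Finset.sum_congr rfl fun _ _ => by ring
    · intro k _ hk; simp [hA, hk]
    · simp
  · rw [Matrix.diagonal_apply_ne _ hij]
    refine Finset.sum_eq_zero fun k _ => Finset.sum_eq_zero fun l _ => ?_
    by_cases hk : k = i
    · have : k ≠ j := fun h => hij (hk ▸ h)
      simp [hA, this]
    · simp [hB, hk]

end Det

/-- The real counterpart of `corrPoly`. -/
noncomputable def corrPolyReal (Θ : Matrix (Fin 3) (Fin 3) ℝ) (u : Fin 3 → ℝ) : ℝ :=
  oppositeCorr Θ 0 ^ 2 * u 1 * u 2 + oppositeCorr Θ 1 ^ 2 * u 2 * u 0 +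
      oppositeCorr Θ 2 ^ 2 * u 0 * u 1 - 2 * (oppositeCorr Θ 0 * u 0 *
        (oppositeCorr Θ 1 * u 1) * (oppositeCorr Θ 2 * u 2))

lemma corrPoly_ofReal (Θ : Matrix (Fin 3) (Fin 3) ℝ) (u : Fin 3 → ℝ) :
    corrPoly Θ (fun j => (u j : ℂ)) = (corrPolyReal Θ u : ℂ) := by
  rw [corrPoly_eq, corrPolyReal]; push_cast; ring

/-- Dividing column `j` by `1 + z j` restores the unit diagonal and scales the off-diagonal entries
by `z j / (1 + z j)`. -/
lemma det_one_add_corr_mul_diagonal {Θ : Matrix (Fin 3) (Fin 3) ℝ}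
    (hΘ : IsNonsingularCorrelation Θ) {z : Fin 3 → ℝ} (hz : ∀ j, 0 ≤ z j) :
    (1 + Θ * Matrix.diagonal z).det =
      (∏ j, (1 + z j)) * (1 - corrPolyReal Θ fun j => z j / (1 + z j)) := by
  have hsym : ∀ i j, Θ i j = Θ j i := fun i j => by
    have := hΘ.1.1.apply i j
    simpa using this.symm
  have z0 : 1 + z 0 ≠ 0 := by have := hz 0; positivity
  have z1 : 1 + z 1 ≠ 0 := by have := hz 1; positivity
  have z2 : 1 + z 2 ≠ 0 := by have := hz 2; positivity
  have o0 : oppositeCorr Θ 0 = Θ 1 2 := rfl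
  have o1 : oppositeCorr Θ 1 = Θ 2 0 := rfl
  have o2 : oppositeCorr Θ 2 = Θ 0 1 := rfl
  rw [Matrix.det_fin_three, Fin.prod_univ_three, corrPolyReal, o0, o1, o2]
  simp only [Matrix.add_apply, Matrix.mul_diagonal, Matrix.one_apply, hΘ.2, hsym 1 0, hsym 2 1,
    hsym 2 0]
  simp
  field_simp
  ring

/-! ### Uniqueness of Laplace transforms on the orthant -/

section Uniqueness

open scoped unitInterval BoundedContinuousFunction

variable {ι : Type*}

/-- The coordinate functions of the cube. -/
noncomputable def cubeCoord (u : ι) : (ι → I) →ᵇ ℝ :=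
  BoundedContinuousFunction.mkOfCompact ⟨fun y => (y u : ℝ), by fun_prop⟩

lemma cubeCoord_apply (u : ι) (y : ι → I) : cubeCoord u y = (y u : ℝ) := rfl

/-- The polynomial functions on the cube. -/
noncomputable def cubePolynomials (ι : Type*) [Fintype ι] : StarSubalgebra ℝ ((ι → I) →ᵇ ℝ) :=
  { (MvPolynomial.aeval (R := ℝ) (cubeCoord (ι := ι))).range with
    star_mem' := fun {g} hg => by
      have : star g = g := by ext y; simp
      rw [this]; exact hg }

lemma cubePolynomials_separatesPoints [Fintype ι] : ((cubePolynomials ι).map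
    (BoundedContinuousFunction.toContinuousMapStarₐ ℝ)).SeparatesPoints := by
  intro x y hxy
  obtain ⟨u, hu⟩ := Function.ne_iff.1 hxy
  refine ⟨_, ⟨_, ⟨cubeCoord u, ⟨MvPolynomial.X u, by simp⟩, rfl⟩, rfl⟩, ?_⟩
  exact fun h => hu (Subtype.ext h)

/-- Mixed moments determine a finite measure on the compact cube, since polynomials separate points
(Stone–Weierstrass). -/
lemma measure_cube_ext [Fintype ι] {P P' : Measure (ι → I)} [IsFiniteMeasure P] [IsFiniteMeasure P']
    (h : ∀ m : ι → ℕ, ∫ y, ∏ u, (y u : ℝ) ^ m u ∂P = ∫ y, ∏ u, (y u : ℝ) ^ m u ∂P') :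
    P = P' := by
  refine ext_of_forall_mem_subalgebra_integral_eq_of_polish (𝕜 := ℝ)
    cubePolynomials_separatesPoints ?_
  rintro _ ⟨q, rfl⟩
  have hq : ∀ y : ι → I, (MvPolynomial.aeval (R := ℝ) (cubeCoord (ι := ι)) q) y =
      ∑ m ∈ q.support, q.coeff m * ∏ u, (y u : ℝ) ^ m u := by
    intro y
    rw [MvPolynomial.aeval_def, MvPolynomial.eval₂_eq']
    simp only [BoundedContinuousFunction.coe_sum, Finset.sum_apply,
      BoundedContinuousFunction.coe_mul, Pi.mul_apply, BoundedContinuousFunction.coe_prod,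
      Finset.prod_apply, BoundedContinuousFunction.coe_pow, Pi.pow_apply, cubeCoord_apply]
    refine Finset.sum_congr rfl fun m _ => ?_
    congr 1
  have hi : ∀ (Q : Measure (ι → I)) [IsFiniteMeasure Q] (m : ι → ℕ),
      Integrable (fun y : ι → I => ∏ u, (y u : ℝ) ^ m u) Q := fun Q _ m => by
    have hc : Continuous (fun y : ι → I => ∏ u, (y u : ℝ) ^ m u) := by fun_prop
    exact (BoundedContinuousFunction.mkOfCompact ⟨_, hc⟩).integrable Q
  simp only [AlgHom.toRingHom_eq_coe, RingHom.coe_coe, hq]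
  have hsum : ∀ (Q : Measure (ι → I)) [IsFiniteMeasure Q],
      ∫ y, ∑ m ∈ q.support, q.coeff m * ∏ u, (y u : ℝ) ^ m u ∂Q =
        ∑ m ∈ q.support, ∫ y, q.coeff m * ∏ u, (y u : ℝ) ^ m u ∂Q := fun Q _ =>
    integral_finsetSum q.support fun m _ => (hi Q m).const_mul (q.coeff m)
  rw [hsum P, hsum P']
  simp_rw [integral_const_mul]
  exact Finset.sum_congr rfl fun m _ => by rw [h]

/-- The map `x ↦ e^{-x}` from the orthant to the cube. -/
noncomputable def expCube (x : ι → ℝ) : ι → I :=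
  fun u => Set.projIcc (0 : ℝ) 1 zero_le_one (Real.exp (-(x u)))

lemma continuous_expCube : Continuous (expCube (ι := ι)) := by
  unfold expCube
  refine continuous_pi fun u => continuous_projIcc.comp (by fun_prop)

lemma expCube_apply {x : ι → ℝ} {u : ι} (hx : 0 ≤ x u) :
    (expCube x u : ℝ) = Real.exp (-(x u)) := by
  rw [expCube, Set.projIcc_of_mem]
  exact ⟨(Real.exp_pos _).le, Real.exp_le_one_iff.2 (by linarith)⟩

/-- Under `x ↦ e^{-x}` the transform at integer points becomes the moments on the cube. These agree
for the measures with densities `f⁺` and `f⁻`, and the map is injective on the orthant, so `f⁺ = f⁻`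
almost everywhere. -/
lemma ae_eq_zero_of_laplace_eq_zero [Fintype ι] {f : (ι → ℝ) → ℝ} (hf : Measurable f) (hi : Integrable f)
    (h0 : ∀ x u, x u < 0 → f x = 0)
    (hl : ∀ m : ι → ℕ, ∫ x : ι → ℝ, (∏ u, Real.exp (-(m u * x u))) * f x = 0) :
    f =ᵐ[volume] 0 := by
  -- `ENNReal.ofReal` truncates at `0`, so `ν f` and `ν (-f)` have densities `f⁺` and `f⁻`.
  set ν : ((ι → ℝ) → ℝ) → Measure (ι → ℝ) :=
    fun g => volume.withDensity fun x => ENNReal.ofReal (g x) with hν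
  have hfin : ∀ g : (ι → ℝ) → ℝ, Integrable g → IsFiniteMeasure (ν g) := fun g hg =>
    isFiniteMeasure_withDensity_ofReal hg.2
  have := hfin f hi
  have := hfin (-f) hi.neg
  have hsupp : ∀ g : (ι → ℝ) → ℝ, Measurable g → (∀ x u, x u < 0 → g x = 0) →
      ∀ᵐ x ∂(ν g), ∀ u, 0 ≤ x u := by
    intro g hg hg0
    rw [hν, ae_withDensity_iff (by fun_prop)]
    refine ae_of_all _ fun x hx u => ?_
    by_contra hxu
    exact hx (by rw [hg0 x u (not_le.1 hxu), ENNReal.ofReal_zero])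
  have hs1 := hsupp f hf h0
  have hs2 := hsupp (-f) hf.neg fun x u hxu => by simp [h0 x u hxu]
  have hrec : ∀ Q : Measure (ι → ℝ), (∀ᵐ x ∂Q, ∀ u, 0 ≤ x u) →
      (Q.map expCube).map (fun y u => -Real.log (y u : ℝ)) = Q := by
    intro Q hQ
    rw [Measure.map_map (by fun_prop) continuous_expCube.measurable]
    conv_rhs => rw [← Measure.map_id (μ := Q)]
    refine Measure.map_congr ?_
    filter_upwards [hQ] with x hx
    ext u
    simp [expCube_apply (hx u)]
  have hint : ∀ (g : (ι → ℝ) → ℝ) (hg : Measurable g)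
      (m : ι → ℕ), (∀ᵐ x ∂(ν g), ∀ u, 0 ≤ x u) →
      ∫ y, ∏ u, (y u : ℝ) ^ m u ∂((ν g).map expCube) =
        ∫ x, (∏ u, Real.exp (-(m u * x u))) * max (g x) 0 := by
    intro g hg m hs
    rw [integral_map continuous_expCube.measurable.aemeasurable
      (Continuous.aestronglyMeasurable (by fun_prop))]
    have h1 : ∀ᵐ x ∂(ν g), ∏ u, (expCube x u : ℝ) ^ m u = ∏ u, Real.exp (-(m u * x u)) := by
      filter_upwards [hs] with x hx
      refine Finset.prod_congr rfl fun u _ => ?_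
      rw [expCube_apply (hx u), ← Real.exp_nat_mul]; congr 1; ring
    rw [integral_congr_ae h1, hν, integral_withDensity_eq_integral_toReal_smul (by fun_prop)
      (ae_of_all _ fun x => ENNReal.ofReal_lt_top)]
    refine integral_congr_ae (ae_of_all _ fun x => ?_)
    simp only [smul_eq_mul, ENNReal.toReal_ofReal']
    ring
  have hbd : ∀ m : ι → ℕ, Integrable fun x : ι → ℝ => (∏ u, Real.exp (-(m u * x u))) * f x := by
    intro m
    refine hi.norm.mono' (Measurable.aestronglyMeasurable (by fun_prop)) (ae_of_all _ fun x => ?_)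
    by_cases hx : ∀ u, 0 ≤ x u
    · rw [norm_mul, norm_prod]
      refine mul_le_of_le_one_left (norm_nonneg _) (Finset.prod_le_one (fun _ _ => norm_nonneg _)
        fun u _ => ?_)
      rw [Real.norm_of_nonneg (Real.exp_pos _).le, Real.exp_le_one_iff, neg_nonpos]
      exact mul_nonneg (Nat.cast_nonneg _) (hx u)
    · push Not at hx
      obtain ⟨u, hu⟩ := hx
      simp [h0 x u hu]
  have hPP : (ν f).map expCube = (ν (-f)).map expCube := by
    refine measure_cube_ext fun m => ?_
    rw [hint f hf m hs1, hint (-f) hf.neg m hs2, ← sub_eq_zero, ← integral_sub]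
    · refine Eq.trans ?_ (hl m)
      refine integral_congr_ae (ae_of_all _ fun x => ?_)
      simp only [Pi.neg_apply]
      rw [← mul_sub]
      congr 1
      exact max_zero_sub_max_neg_zero_eq_self (f x)
    · have hpos : ∀ x, (∏ u, Real.exp (-(m u * x u))) * max (f x) 0 =
          max ((∏ u, Real.exp (-(m u * x u))) * f x) 0 := fun x => by
        rw [mul_max_of_nonneg _ _ (Finset.prod_nonneg fun _ _ => (Real.exp_pos _).le), mul_zero]
      simp_rw [hpos]
      exact (hbd m).pos_part
    · have hpos : ∀ x, (∏ u, Real.exp (-(m u * x u))) * max ((-f) x) 0 =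
          max (-((∏ u, Real.exp (-(m u * x u))) * f x)) 0 := fun x => by
        rw [mul_max_of_nonneg _ _ (Finset.prod_nonneg fun _ _ => (Real.exp_pos _).le), mul_zero]
        simp
      simp_rw [hpos]
      exact (hbd m).neg_part
  have hνν : ν f = ν (-f) := by rw [← hrec _ hs1, ← hrec _ hs2, hPP]
  have := (withDensity_eq_iff (by fun_prop) (by fun_prop) (by
    have := hi.2
    exact (measure_lt_top (ν f) univ).ne ∘ fun h => by
      rw [hν, withDensity_apply _ MeasurableSet.univ, Measure.restrict_univ]; exact h)).1 hνν
  filter_upwards [this] with x hx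
  simp only [Pi.neg_apply] at hx
  have h1 := congrArg ENNReal.toReal hx
  rw [ENNReal.toReal_ofReal', ENNReal.toReal_ofReal'] at h1
  have := max_zero_sub_max_neg_zero_eq_self (f x)
  simp only [Pi.zero_apply]
  linarith

end Uniqueness

/-! ### The binomial series and the bound for the terms -/

lemma hasSum_ascPochhammer_mul_pow (α : ℝ) {x : ℝ} (hx : |x| < 1) :
    HasSum (fun k : ℕ => (ascPochhammer ℝ k).eval α / k ! * x ^ k) ((1 - x) ^ (-α)) := by
  have h := (Real.one_div_one_sub_rpow_hasFPowerSeriesOnBall_zero α).hasSum (y := x) (by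
    simpa [enorm_eq_nnnorm, ← NNReal.coe_lt_coe] using hx)
  have h1 : 0 ≤ 1 - x := by linarith [(abs_lt.1 hx).2]
  simp only [zero_add, one_div, ← Real.rpow_neg h1] at h
  simp only [FormalMultilinearSeries.ofScalars_apply_eq, ring_choose_add_eq_ascPochhammer,
    smul_eq_mul] at h
  exact h

section Term

variable {n : Fin 3 → ℕ} {α : ℝ} {Θ : Matrix (Fin 3) (Fin 3) ℝ} {a : (j : Fin 3) → Fin (n j) → ℝ}

/-- An integrable majorant of the transforms on the line `re s = 1`. -/
noncomputable def lineMajorant (α : ℝ) (a : (j : Fin 3) → Fin (n j) → ℝ)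
    (w : ((j : Fin 3) × Fin (n j)) → ℝ) : ℝ :=
  ∏ u, (2 * ((1 - a u.1 u.2 ^ 2) / 2) ^ (-α)) * (1 + ‖w u‖) ^ (-(1 + α))

lemma integrable_lineMajorant (hα : 0 < α) (a : (j : Fin 3) → Fin (n j) → ℝ) :
    Integrable (lineMajorant α a) :=
  Integrable.fintype_prod (f := fun (u : (j : Fin 3) × Fin (n j)) (t : ℝ) =>
    (2 * ((1 - a u.1 u.2 ^ 2) / 2) ^ (-α)) * (1 + ‖t‖) ^ (-(1 + α)))
    fun _ => integrable_marginal_bound hα _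

lemma lineMajorant_nonneg (ha : ∀ j i, 0 < a j i ∧ a j i < 1)
    (w : ((j : Fin 3) × Fin (n j)) → ℝ) : 0 ≤ lineMajorant α a w :=
  Finset.prod_nonneg fun u _ => by
    have := one_sub_sq_pos (ha u.1 u.2)
    positivity

/-- The estimate separates `w` from `k`: one integrable majorant serves all terms, and `k` enters
only through a coefficient of the binomial series at `q`. -/
lemma norm_integral_exp_mul_gammaSeriesTerm_le (hα : 0 < α) (ha : ∀ j i, 0 < a j i ∧ a j i < 1)
    {q : ℝ} (hq : ∀ u : Fin 3 → ℂ,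
      (∀ j, Complex.normSq (u j) ≤ blockRadius (a j) * (u j).re) → ‖corrPoly Θ u‖ ≤ q)
    (k : ℕ) (w : ((j : Fin 3) × Fin (n j)) → ℝ) :
    ‖∫ x : ((j : Fin 3) × Fin (n j)) → ℝ, (∏ u, Complex.exp
      (-((1 + ((2 * Real.pi * w u : ℝ) : ℂ) * Complex.I) * x u))) *
        (gammaSeriesTerm α Θ a x k : ℂ)‖ ≤
      lineMajorant α a w * ((ascPochhammer ℝ k).eval α / k ! * q ^ k) := by
  have hck : 0 ≤ (ascPochhammer ℝ k).eval α / k ! :=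
    div_nonneg (ascPochhammer_pos _ _ hα).le (by positivity)
  have hsre : ∀ u : (j : Fin 3) × Fin (n j),
      0 < (1 + ((2 * Real.pi * w u : ℝ) : ℂ) * Complex.I).re := fun u => by simp
  rw [integral_exp_mul_gammaSeriesTerm hα ha k
    (s := fun u => 1 + ((2 * Real.pi * w u : ℝ) : ℂ) * Complex.I) hsre, norm_mul, norm_mul,
    norm_mul, norm_pow, Complex.norm_real, Real.norm_of_nonneg hck, norm_prod, norm_prod]
  refine mul_le_mul ?_ ?_ (mul_nonneg hck (pow_nonneg (norm_nonneg _) _))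
    (lineMajorant_nonneg ha w)
  · rw [← mul_one (lineMajorant α a w)]
    refine mul_le_mul ?_ ?_ (Finset.prod_nonneg fun _ _ => norm_nonneg _) (lineMajorant_nonneg ha w)
    · exact Finset.prod_le_prod (fun _ _ => norm_nonneg _) fun u _ =>
        norm_marginal_factor_le hα (one_sub_sq_pos (ha u.1 u.2)) (w u)
    · exact Finset.prod_le_one (fun _ _ => norm_nonneg _) fun j _ =>
        norm_one_add_cpow_neg_le_one hα (blockShift_re_nonneg (ha j) fun i => hsre _)
  · refine mul_le_mul_of_nonneg_left (pow_le_pow_left₀ (norm_nonneg _) (hq _ fun j => ?_) k) hck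
    exact normSq_blockRatio_le (ha j) fun i => hsre _

lemma exists_norm_gammaSeriesTerm_le_geometric (hα : 0 < α) (ha : ∀ j i, 0 < a j i ∧ a j i < 1)
    {q : ℝ} (hq : ∀ u : Fin 3 → ℂ,
      (∀ j, Complex.normSq (u j) ≤ blockRadius (a j) * (u j).re) → ‖corrPoly Θ u‖ ≤ q) :
    ∃ K : ℝ, ∀ k x, ‖gammaSeriesTerm α Θ a x k‖ ≤
      (K * ((ascPochhammer ℝ k).eval α / k ! * q ^ k)) * Real.exp (∑ u, 1 * x u) := by
  refine ⟨∫ w, lineMajorant α a w, fun k x => ?_⟩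
  obtain ⟨C, hC⟩ := exists_norm_gammaSeriesTerm_le (Θ := Θ) hα ha k
  have hint := integrable_exp_mul_of_bounded_orthant (c := 0) (C := C) (s := fun _ => 1)
      (continuous_gammaSeriesTerm (Θ := Θ) hα ha k).measurable
      (fun x u hu => gammaSeriesTerm_of_nonpos hα ha k hu.le) (fun x => by simpa using hC x)
      (by simp)
  have h := norm_le_of_norm_laplace_le (continuous_gammaSeriesTerm (Θ := Θ) hα ha k) hint
    ((integrable_lineMajorant hα a).mul_const _)
    (norm_integral_exp_mul_gammaSeriesTerm_le hα ha hq k) x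
  rwa [integral_mul_const] at h

/-- The Laplace transform of the multivariate gamma distribution function without the
factor `(1 - P)^{-α}`. -/
noncomputable def laplacePrefactor (α : ℝ) (a : (j : Fin 3) → Fin (n j) → ℝ)
    (t : ((j : Fin 3) × Fin (n j)) → ℝ) : ℝ :=
  (∏ u, (t u)⁻¹ * (1 + (1 - a u.1 u.2 ^ 2) * t u) ^ (-α)) *
    ∏ j, (1 + blockShiftReal (a j) fun i => t ⟨j, i⟩) ^ (-α)

/-- The argument of the binomial series at a real point. -/
noncomputable def corrAt (Θ : Matrix (Fin 3) (Fin 3) ℝ) (a : (j : Fin 3) → Fin (n j) → ℝ)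
    (t : ((j : Fin 3) × Fin (n j)) → ℝ) : ℝ :=
  corrPolyReal Θ fun j => (blockShiftReal (a j) fun i => t ⟨j, i⟩) /
    (1 + blockShiftReal (a j) fun i => t ⟨j, i⟩)

lemma blockRatio_ofReal {m : ℕ} (a t : Fin m → ℝ) :
    blockRatio a (fun i => (t i : ℂ)) = ((blockShiftReal a t / (1 + blockShiftReal a t) : ℝ) : ℂ) := by
  rw [blockRatio, blockShift_ofReal]; push_cast; rfl

lemma integral_exp_mul_gammaSeriesTerm_ofReal (hα : 0 < α) (ha : ∀ j i, 0 < a j i ∧ a j i < 1)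
    (k : ℕ) {t : ((j : Fin 3) × Fin (n j)) → ℝ} (ht : ∀ u, 0 < t u) :
    ∫ x : ((j : Fin 3) × Fin (n j)) → ℝ, (∏ u, Complex.exp (-((t u : ℂ) * x u))) *
      (gammaSeriesTerm α Θ a x k : ℂ) =
    ((laplacePrefactor α a t * ((ascPochhammer ℝ k).eval α / k ! * corrAt Θ a t ^ k) : ℝ) : ℂ) := by
  rw [integral_exp_mul_gammaSeriesTerm hα ha k (s := fun u => (t u : ℂ)) (by simpa using ht)]
  have hu : ∀ u, ((1 + (1 - a u.1 u.2 ^ 2) * t u : ℝ) : ℂ) ^ (-(α : ℂ)) =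
      (((1 + (1 - a u.1 u.2 ^ 2) * t u) ^ (-α) : ℝ) : ℂ) := fun u => by
    have := mul_pos (one_sub_sq_pos (ha u.1 u.2)) (ht u)
    rw [Complex.ofReal_cpow (by positivity)]; push_cast; rfl
  have hj : ∀ j, ((1 + blockShiftReal (a j) fun i => t ⟨j, i⟩ : ℝ) : ℂ) ^ (-(α : ℂ)) =
      (((1 + blockShiftReal (a j) fun i => t ⟨j, i⟩) ^ (-α) : ℝ) : ℂ) := fun j => by
    have := blockShiftReal_nonneg (ha j) (t := fun i => t ⟨j, i⟩) fun i => ht _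
    rw [Complex.ofReal_cpow (by positivity)]; push_cast; rfl
  have hc : corrPoly Θ (fun j => blockRatio (a j) fun i => (t ⟨j, i⟩ : ℂ)) =
      (corrAt Θ a t : ℂ) := by
    rw [corrAt, ← corrPoly_ofReal]
    congr 1; ext j
    exact blockRatio_ofReal (a j) fun i => t ⟨j, i⟩
  have hb : ∀ j, blockShift (a j) (fun i => (t ⟨j, i⟩ : ℂ)) =
      (blockShiftReal (a j) fun i => t ⟨j, i⟩ : ℝ) := fun j =>
    blockShift_ofReal (a j) fun i => t ⟨j, i⟩
  rw [hc]
  simp only [hb, laplacePrefactor, Complex.ofReal_mul, Complex.ofReal_prod, Complex.ofReal_pow,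
    ← hu, ← hj]
  push_cast
  rfl

lemma abs_corrAt_le (ha : ∀ j i, 0 < a j i ∧ a j i < 1)
    {q : ℝ} (hq : ∀ u : Fin 3 → ℂ,
      (∀ j, Complex.normSq (u j) ≤ blockRadius (a j) * (u j).re) → ‖corrPoly Θ u‖ ≤ q)
    {t : ((j : Fin 3) × Fin (n j)) → ℝ} (ht : ∀ u, 0 < t u) : |corrAt Θ a t| ≤ q := by
  rw [← Real.norm_eq_abs, ← Complex.norm_real, corrAt, ← corrPoly_ofReal]
  refine hq _ fun j => ?_
  rw [← blockRatio_ofReal]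
  exact normSq_blockRatio_le (ha j) fun i => by simpa using ht _

/-- The bound on `corrAt` makes the last factor of the determinant positive, so the real power
distributes over the product. -/
lemma det_rpow_eq (hΘ : IsNonsingularCorrelation Θ) (ha : ∀ j i, 0 < a j i ∧ a j i < 1)
    {t : ((j : Fin 3) × Fin (n j)) → ℝ} (ht : ∀ u, 0 < t u) (hc : corrAt Θ a t < 1) :
    (∏ u, (t u)⁻¹) * (1 + blockCorrelation Θ a * Matrix.diagonal t).det ^ (-α) =
      laplacePrefactor α a t * (1 - corrAt Θ a t) ^ (-α) := by
  have hz : ∀ j, 0 ≤ blockShiftReal (a j) fun i => t ⟨j, i⟩ :=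
    fun j => blockShiftReal_nonneg (ha j) fun i => ht _
  have he : ∀ u, 0 ≤ 1 + (1 - a u.1 u.2 ^ 2) * t u := fun u => by
    have := mul_pos (one_sub_sq_pos (ha u.1 u.2)) (ht u)
    positivity
  have hz1 : ∀ j, 0 ≤ 1 + blockShiftReal (a j) fun i => t ⟨j, i⟩ := fun j => by
    have := hz j; positivity
  rw [det_one_add_blockCorrelation_mul_diagonal Θ ha ht, det_one_add_corr_mul_diagonal hΘ hz]
  change _ * (_ * (_ * (1 - corrAt Θ a t))) ^ (-α) = _
  rw [Real.mul_rpow (Finset.prod_nonneg fun u _ => he u)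
      (mul_nonneg (Finset.prod_nonneg fun j _ => hz1 j) (sub_pos.2 hc).le),
    Real.mul_rpow (Finset.prod_nonneg fun j _ => hz1 j) (sub_pos.2 hc).le,
    ← Real.finsetProd_rpow _ _ (fun u _ => he u), ← Real.finsetProd_rpow _ _ (fun j _ => hz1 j),
    laplacePrefactor, Finset.prod_mul_distrib]
  ring

end Term

/-! ### Distribution functions on the orthant -/

section Cdf

variable {ι : Type*}

lemma integrableOn_prod_exp_Ici [Fintype ι] {s : ι → ℂ} (hs : ∀ u, 0 < (s u).re) (y : ι → ℝ) :
    IntegrableOn (fun x : ι → ℝ => ∏ u, Complex.exp (-(s u * x u))) (Ici y) := by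
  rw [IntegrableOn, ← pi_univ_Ici, volume_pi, Measure.restrict_pi_pi]
  exact Integrable.fintype_prod (f := fun u (x : ℝ) => Complex.exp (-(s u * x)))
    fun u => integrableOn_exp_neg_mul_Ici (hs u) (y u)

lemma integral_prod_exp_Ici [Fintype ι] {s : ι → ℂ} (hs : ∀ u, 0 < (s u).re) (y : ι → ℝ) :
    ∫ x in Ici y, ∏ u, Complex.exp (-(s u * x u)) =
      (∏ u, (s u)⁻¹) * ∏ u, Complex.exp (-(s u * y u)) := by
  rw [← pi_univ_Ici, volume_pi, Measure.restrict_pi_pi,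
    integral_fintype_prod_eq_prod (fun u (x : ℝ) => Complex.exp (-(s u * x)))]
  simp_rw [integral_exp_neg_mul_Ici (hs _)]
  rw [Finset.prod_mul_distrib]

lemma integral_prod_exp_mul_measureReal_Iic [Fintype ι] {μ : Measure (ι → ℝ)} [IsFiniteMeasure μ]
    (hμ : ∀ᵐ x ∂μ, ∀ u, 0 ≤ x u) {t : ι → ℝ} (ht : ∀ u, 0 < t u) :
    ∫ x : ι → ℝ, (∏ u, Complex.exp (-((t u : ℂ) * x u))) * (μ.real (Iic x) : ℂ) =
      (((∏ u, (t u)⁻¹) * ∫ x, Real.exp (-∑ u, t u * x u) ∂μ : ℝ) : ℂ) := by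
  have hs : ∀ u, 0 < ((t u : ℂ)).re := by simpa using ht
  rw [integral_mul_measureReal_Iic (hμ.mono fun x hx => hx) (integrableOn_prod_exp_Ici hs 0)]
  simp_rw [integral_prod_exp_Ici hs]
  rw [integral_const_mul, Complex.ofReal_mul, ← integral_complex_ofReal]
  congr 1
  · push_cast; rfl
  · refine integral_congr_ae (ae_of_all _ fun x => ?_)
    simp only
    rw [← Complex.exp_sum]
    push_cast
    rw [Finset.sum_neg_distrib]

lemma measureReal_Iic_of_neg {μ : Measure (ι → ℝ)} (hμ : ∀ᵐ x ∂μ, ∀ u, 0 ≤ x u) {x : ι → ℝ}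
    {u : ι} (hu : x u < 0) : μ.real (Iic x) = 0 := by
  have : μ (Iic x) = 0 := by
    refine measure_mono_null (fun y hy => ?_) (ae_iff.1 hμ)
    simp only [mem_ofPred_eq, not_forall, not_le]
    exact ⟨u, lt_of_le_of_lt (hy u) hu⟩
  simp [Measure.real, this]

lemma measureReal_Iic_mono {μ : Measure (ι → ℝ)} [IsFiniteMeasure μ] :
    Monotone fun x : ι → ℝ => μ.real (Iic x) :=
  fun _ _ h => measureReal_mono (Iic_subset_Iic.2 h)

lemma measurable_measureReal_Iic [Fintype ι] {μ : Measure (ι → ℝ)} [IsFiniteMeasure μ] :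
    Measurable fun x : ι → ℝ => μ.real (Iic x) := by
  have hS : MeasurableSet {p : (ι → ℝ) × (ι → ℝ) | p.2 ≤ p.1} :=
    measurableSet_le measurable_snd measurable_fst
  exact (measurable_measure_prodMk_left hS).ennreal_toReal

lemma tendsto_measureReal_Iic_add [Fintype ι] {μ : Measure (ι → ℝ)} [IsFiniteMeasure μ] (x : ι → ℝ) :
    Filter.Tendsto (fun m : ℕ => μ.real (Iic fun u => x u + 1 / ((m : ℝ) + 1))) Filter.atTop
      (nhds (μ.real (Iic x))) := by
  have hI : ⋂ m : ℕ, Iic (fun u => x u + 1 / ((m : ℝ) + 1)) = Iic x := by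
    ext y
    simp only [mem_iInter, mem_Iic]
    constructor
    · intro h u
      refine ge_of_tendsto' (x := Filter.atTop) (f := fun m : ℕ => x u + 1 / ((m : ℝ) + 1)) ?_
        fun m => h m u
      simpa using tendsto_const_nhds.add (tendsto_one_div_add_atTop_nhds_zero_nat (𝕜 := ℝ))
    · intro h m u
      have : (0 : ℝ) < 1 / ((m : ℝ) + 1) := by positivity
      linarith [h u]
  have h := tendsto_measure_iInter_atTop (μ := μ)
    (s := fun m : ℕ => Iic (fun u => x u + 1 / ((m : ℝ) + 1)))
    (fun m => measurableSet_Iic.nullMeasurableSet) (fun a b hab => Iic_subset_Iic.2 fun u => by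
      have : (a : ℝ) ≤ b := Nat.cast_le.2 hab
      gcongr) ⟨0, measure_ne_top _ _⟩
  rw [hI] at h
  exact (ENNReal.tendsto_toReal (measure_ne_top _ _)).comp h

/-- A continuous function which agrees almost everywhere with a distribution function agrees with
it everywhere. -/
lemma measureReal_Iic_eq_of_ae_eq [Fintype ι] {μ : Measure (ι → ℝ)} [IsFiniteMeasure μ] {H : (ι → ℝ) → ℝ}
    (hH : Continuous H) (h : ∀ᵐ x, μ.real (Iic x) = H x) (x : ι → ℝ) : μ.real (Iic x) = H x := by
  have hd : Dense {x | μ.real (Iic x) = H x} := Measure.dense_of_ae h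
  -- Good points are taken strictly above `x` in every coordinate, so monotonicity squeezes the cdf
  -- there between its values at `x` and at the upper corner of the box.
  have hex : ∀ m : ℕ, ∃ y, μ.real (Iic y) = H y ∧
      ∀ u, x u < y u ∧ y u < x u + 1 / ((m : ℝ) + 1) := by
    intro m
    have hm : (0 : ℝ) < 1 / ((m : ℝ) + 1) := by positivity
    obtain ⟨y, hy, hyH⟩ := hd.exists_mem_open
      (isOpen_set_pi (finite_univ (α := ι)) fun u _ =>
        isOpen_Ioo (a := x u) (b := x u + 1 / ((m : ℝ) + 1)))
      ⟨fun u => x u + 1 / ((m : ℝ) + 1) / 2, fun u _ => ⟨by linarith, by linarith⟩⟩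
    exact ⟨y, hy, fun u => hyH u (mem_univ u)⟩
  choose y hyH hyx using hex
  have hlim : Filter.Tendsto y Filter.atTop (nhds x) := by
    refine tendsto_pi_nhds.2 fun u => ?_
    refine tendsto_of_tendsto_of_tendsto_of_le_of_le tendsto_const_nhds ?_
      (fun m => (hyx m u).1.le) (fun m => (hyx m u).2.le)
    simpa using tendsto_const_nhds.add (tendsto_one_div_add_atTop_nhds_zero_nat (𝕜 := ℝ))
  have h1 : Filter.Tendsto (fun m => μ.real (Iic (y m))) Filter.atTop (nhds (μ.real (Iic x))) :=
    tendsto_of_tendsto_of_tendsto_of_le_of_le tendsto_const_nhds (tendsto_measureReal_Iic_add x)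
      (fun m => measureReal_Iic_mono fun u => (hyx m u).1.le)
      (fun m => measureReal_Iic_mono fun u => (hyx m u).2.le)
  simp_rw [hyH] at h1
  exact tendsto_nhds_unique h1 ((hH.tendsto x).comp hlim)

end Cdf

/-! ### The series for the distribution function -/

section Term

variable {n : Fin 3 → ℕ} {α : ℝ} {Θ : Matrix (Fin 3) (Fin 3) ℝ} {a : (j : Fin 3) → Fin (n j) → ℝ}

lemma summable_gammaSeriesTerm {c : ℕ → ℝ} (hc : Summable c)
    (hb : ∀ k x, ‖gammaSeriesTerm α Θ a x k‖ ≤ c k * Real.exp (∑ u, 1 * x u))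
    (x : ((j : Fin 3) × Fin (n j)) → ℝ) : Summable (gammaSeriesTerm α Θ a x) :=
  Summable.of_norm_bounded (hc.mul_right _) fun k => hb k x

lemma continuous_tsum_gammaSeriesTerm (hα : 0 < α) (ha : ∀ j i, 0 < a j i ∧ a j i < 1)
    {c : ℕ → ℝ} (hc : Summable c)
    (hb : ∀ k x, ‖gammaSeriesTerm α Θ a x k‖ ≤ c k * Real.exp (∑ u, 1 * x u)) :
    Continuous fun x => ∑' k, gammaSeriesTerm α Θ a x k := by
  -- Extracting the common growth factor leaves terms bounded uniformly in `x`, so the Weierstrass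
  -- test applies.
  have h : ∀ x, ∑' k, gammaSeriesTerm α Θ a x k = Real.exp (∑ u, 1 * x u) *
      ∑' k, Real.exp (-∑ u, 1 * x u) * gammaSeriesTerm α Θ a x k := by
    intro x
    rw [tsum_mul_left, ← mul_assoc, ← Real.exp_add]; simp
  simp_rw [h]
  refine Continuous.mul (by fun_prop) (continuous_tsum (fun k => ?_) hc fun k x => ?_)
  · have := continuous_gammaSeriesTerm (Θ := Θ) hα ha k
    fun_prop
  · rw [norm_mul, Real.norm_of_nonneg (Real.exp_pos _).le, Real.exp_neg,
      inv_mul_le_iff₀ (Real.exp_pos _), mul_comm]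
    exact hb k x

lemma norm_tsum_gammaSeriesTerm_le {c : ℕ → ℝ} (hc : Summable c)
    (hb : ∀ k x, ‖gammaSeriesTerm α Θ a x k‖ ≤ c k * Real.exp (∑ u, 1 * x u))
    (x : ((j : Fin 3) × Fin (n j)) → ℝ) :
    ‖∑' k, gammaSeriesTerm α Θ a x k‖ ≤ (∑' k, c k) * Real.exp (∑ u, 1 * x u) := by
  rw [← tsum_mul_right]
  exact tsum_of_norm_bounded (hc.mul_right _).hasSum fun k => hb k x

/-- For `1 < t u` the kernel beats the growth `e^{∑ x}` and the norms of the terms are summable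
after integration. The transforms then add up to the binomial series at `corrAt`. -/
lemma integral_exp_mul_tsum_gammaSeriesTerm (hα : 0 < α) (ha : ∀ j i, 0 < a j i ∧ a j i < 1)
    {c : ℕ → ℝ} (hc : Summable c)
    (hb : ∀ k x, ‖gammaSeriesTerm α Θ a x k‖ ≤ c k * Real.exp (∑ u, 1 * x u))
    {t : ((j : Fin 3) × Fin (n j)) → ℝ} (ht : ∀ u, 1 < t u) (hP : |corrAt Θ a t| < 1) :
    ∫ x : ((j : Fin 3) × Fin (n j)) → ℝ, (∏ u, Complex.exp (-((t u : ℂ) * x u))) *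
      ((∑' k, gammaSeriesTerm α Θ a x k : ℝ) : ℂ) =
    ((laplacePrefactor α a t * (1 - corrAt Θ a t) ^ (-α) : ℝ) : ℂ) := by
  have hts : ∀ u, 1 < ((t u : ℂ)).re := by simpa using ht
  have h0 : ∀ k (x : ((j : Fin 3) × Fin (n j)) → ℝ) u, x u < 0 → gammaSeriesTerm α Θ a x k = 0 :=
    fun k x u hu => gammaSeriesTerm_of_nonpos hα ha k hu.le
  have hint : ∀ k, Integrable fun x : ((j : Fin 3) × Fin (n j)) → ℝ =>
      (∏ u, Complex.exp (-((t u : ℂ) * x u))) * (gammaSeriesTerm α Θ a x k : ℂ) := fun k =>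
    integrable_exp_mul_of_bounded_orthant (c := fun _ => 1)
      (continuous_gammaSeriesTerm hα ha k).measurable (h0 k) (hb k) hts
  have hsum : Summable fun k => ∫ x : ((j : Fin 3) × Fin (n j)) → ℝ,
      ‖(∏ u, Complex.exp (-((t u : ℂ) * x u))) * (gammaSeriesTerm α Θ a x k : ℂ)‖ := by
    refine Summable.of_nonneg_of_le (fun k => integral_nonneg fun _ => norm_nonneg _) (fun k => ?_)
      (hc.mul_right (∫ x : ((j : Fin 3) × Fin (n j)) → ℝ, ∏ u, (Ici (0 : ℝ)).indicator
        (fun x => Real.exp (-((((t u : ℂ)).re - 1) * x))) (x u)))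
    rw [← integral_const_mul]
    exact integral_mono (hint k).norm
      ((integrable_prod_indicator_exp (c := fun _ => 1) hts).const_mul _)
      (norm_exp_mul_le_of_bounded_orthant (h0 k) (hb k) _)
  have h := hasSum_integral_of_summable_integral_norm hint hsum
  simp_rw [integral_exp_mul_gammaSeriesTerm_ofReal hα ha _ fun u => one_pos.trans (ht u)] at h
  have h2 := Complex.hasSum_ofReal.2
    ((hasSum_ascPochhammer_mul_pow α hP).mul_left (laplacePrefactor α a t))
  rw [← h.unique h2]
  refine integral_congr_ae (ae_of_all _ fun x => ?_)
  simp only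
  rw [tsum_mul_left, Complex.ofReal_tsum]

theorem hasSum_gammaSeriesTerm (hα : 0 < α) (ha : ∀ j i, 0 < a j i ∧ a j i < 1)
    (hΘ : IsNonsingularCorrelation Θ) (hmax : MaxRhoSqLtOne Θ a)
    {μ : Measure (((j : Fin 3) × Fin (n j)) → ℝ)}
    (hμ : IsMultivariateGamma α (blockCorrelation Θ a) μ)
    (x : ((j : Fin 3) × Fin (n j)) → ℝ) :
    HasSum (gammaSeriesTerm α Θ a x) (μ.real (Iic x)) := by
  have := hμ.isProbabilityMeasure
  obtain ⟨q, hq0, hq1, hq⟩ := hmax.exists_norm_corrPoly_le ha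
  obtain ⟨K, hb⟩ := exists_norm_gammaSeriesTerm_le_geometric hα ha hq
  have hc : Summable fun k : ℕ => K * ((ascPochhammer ℝ k).eval α / k ! * q ^ k) :=
    (hasSum_ascPochhammer_mul_pow α (by rwa [abs_of_nonneg hq0])).summable.mul_left K
  set H : (((j : Fin 3) × Fin (n j)) → ℝ) → ℝ := fun x => ∑' k, gammaSeriesTerm α Θ a x k with hH
  have hHc : Continuous H := continuous_tsum_gammaSeriesTerm hα ha hc hb
  have hH0 : ∀ x u, x u < 0 → H x = 0 := fun x u hu => by
    simp only [hH]
    simp [gammaSeriesTerm_of_nonpos hα ha _ hu.le]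
  have hFint : ∀ t : ((j : Fin 3) × Fin (n j)) → ℝ, (∀ u, 1 < t u) →
      Integrable fun x : ((j : Fin 3) × Fin (n j)) → ℝ =>
        (∏ u, Complex.exp (-((t u : ℂ) * x u))) * (μ.real (Iic x) : ℂ) := fun t ht =>
    integrable_exp_mul_of_bounded_orthant (c := 0) (C := 1) measurable_measureReal_Iic
      (fun x u hu => measureReal_Iic_of_neg hμ.nonneg hu) (fun x => by
        simp [abs_of_nonneg, measureReal_le_one]) fun u => by simpa using one_pos.trans (ht u)
  have hHint : ∀ t : ((j : Fin 3) × Fin (n j)) → ℝ, (∀ u, 1 < t u) →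
      Integrable fun x : ((j : Fin 3) × Fin (n j)) → ℝ =>
        (∏ u, Complex.exp (-((t u : ℂ) * x u))) * (H x : ℂ) := fun t ht =>
    integrable_exp_mul_of_bounded_orthant (c := fun _ => 1) hHc.measurable hH0
      (norm_tsum_gammaSeriesTerm_le hc hb) fun u => by simpa using ht u
  have hL : ∀ t : ((j : Fin 3) × Fin (n j)) → ℝ, (∀ u, 1 < t u) →
      ∫ x : ((j : Fin 3) × Fin (n j)) → ℝ,
        (∏ u, Complex.exp (-((t u : ℂ) * x u))) * ((μ.real (Iic x) - H x : ℝ) : ℂ) = 0 := by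
    intro t ht
    have ht0 : ∀ u, 0 < t u := fun u => one_pos.trans (ht u)
    have hP : |corrAt Θ a t| < 1 := (abs_corrAt_le ha hq ht0).trans_lt hq1
    simp_rw [Complex.ofReal_sub, mul_sub]
    rw [integral_sub (hFint t ht) (hHint t ht), integral_prod_exp_mul_measureReal_Iic hμ.nonneg ht0,
      hμ.laplace t fun u => (ht0 u).le, det_rpow_eq hΘ ha ht0 (abs_lt.1 hP).2,
      integral_exp_mul_tsum_gammaSeriesTerm hα ha hc hb ht hP, sub_self]
  -- The damping `e^{-2x}` makes the difference integrable and shifts the integer points `m ≥ 0` to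
  -- `m + 2`, inside the region where the transforms are known to agree.
  set f : (((j : Fin 3) × Fin (n j)) → ℝ) → ℝ :=
    fun x => (∏ u, Real.exp (-(2 * x u))) * (μ.real (Iic x) - H x) with hf
  have hfc : ∀ x, (f x : ℂ) = (∏ u, Complex.exp (-(((2 : ℝ) : ℂ) * x u))) *
      ((μ.real (Iic x) - H x : ℝ) : ℂ) := fun x => by
    simp only [hf]; push_cast; rfl
  have hfm : Measurable f :=
    Measurable.mul (by fun_prop) (measurable_measureReal_Iic.sub hHc.measurable)
  have hfi : Integrable f := by
    have h2 := (hFint (fun _ => 2) fun _ => by norm_num).sub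
      (hHint (fun _ => 2) fun _ => by norm_num)
    have h3 : Integrable fun x => (f x : ℂ) := by
      refine h2.congr (ae_of_all _ fun x => ?_)
      simp only [Pi.sub_apply]
      rw [hfc, Complex.ofReal_sub, mul_sub]
    exact h3.re
  have hzero := ae_eq_zero_of_laplace_eq_zero hfm hfi
    (fun x u hu => by simp [hf, measureReal_Iic_of_neg hμ.nonneg hu, hH0 x u hu]) fun m => by
      have h := hL (fun u => (m u : ℝ) + 2) fun u => by
        have : (0 : ℝ) ≤ m u := Nat.cast_nonneg _
        linarith
      apply Complex.ofReal_injective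
      rw [← integral_complex_ofReal, Complex.ofReal_zero, ← h]
      refine integral_congr_ae (ae_of_all _ fun x => ?_)
      simp only
      rw [Complex.ofReal_mul, hfc, ← mul_assoc]
      congr 1
      rw [Complex.ofReal_prod, ← Finset.prod_mul_distrib]
      refine Finset.prod_congr rfl fun u _ => ?_
      rw [Complex.ofReal_exp, ← Complex.exp_add]
      congr 1; push_cast; ring
  have hae : ∀ᵐ x, μ.real (Iic x) = H x := by
    filter_upwards [hzero] with x hx
    have hpos : (∏ u, Real.exp (-(2 * x u))) ≠ 0 :=
      Finset.prod_ne_zero_iff.2 fun u _ => (Real.exp_pos _).ne'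
    exact sub_eq_zero.1 ((mul_eq_zero.1 hx).resolve_left hpos)
  rw [measureReal_Iic_eq_of_ae_eq hHc hae x]
  exact (summable_gammaSeriesTerm hc hb x).hasSum

end Term

/-! ### A sufficient condition for convergence -/

/-- Cauchy–Schwarz bounds the second square by `X² + Y² + Z²`, and this plus `C²` is part of the
expansion of `∏ (c² + s²) = 1`. Strictness comes from `S < 1` when `C ≠ 0`; if a cosine vanishes,
only one term survives and `p² < 1` suffices. -/
lemma normSq_trig_corr_lt_one {p₀ p₁ p₂ c₀ c₁ c₂ s₀ s₁ s₂ S : ℝ}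
    (h₀ : c₀ ^ 2 + s₀ ^ 2 = 1) (h₁ : c₁ ^ 2 + s₁ ^ 2 = 1) (h₂ : c₂ ^ 2 + s₂ ^ 2 = 1)
    (hp₀ : p₀ ^ 2 < 1) (hp₁ : p₁ ^ 2 < 1) (hp₂ : p₂ ^ 2 < 1) (hS0 : 0 ≤ S) (hS1 : S < 1)
    (hp : p₀ ^ 4 + p₁ ^ 4 + p₂ ^ 4 ≤ 1) :
    (S * (c₀ * c₁ * c₂)) ^ 2 + (p₀ ^ 2 * (c₁ * c₂ * s₀) + p₁ ^ 2 * (c₂ * c₀ * s₁) +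
      p₂ ^ 2 * (c₀ * c₁ * s₂)) ^ 2 < 1 := by
  have edge : ∀ {p c s c' : ℝ}, p ^ 2 < 1 → c ^ 2 ≤ 1 → c' ^ 2 ≤ 1 → s ^ 2 ≤ 1 →
      (p ^ 2 * (c * c' * s)) ^ 2 < 1 := by
    intro p c s c' hp hc hc' hs
    have h1 : (c * c' * s) ^ 2 ≤ 1 := by
      rw [mul_pow, mul_pow]
      exact mul_le_one₀ (mul_le_one₀ hc (sq_nonneg _) hc') (sq_nonneg _) hs
    rw [mul_pow]
    have h2 : (p ^ 2) ^ 2 < 1 := pow_lt_one₀ (sq_nonneg _) hp two_ne_zero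
    nlinarith [sq_nonneg (p ^ 2), sq_nonneg (c * c' * s)]
  have hc₀ : c₀ ^ 2 ≤ 1 := by nlinarith [sq_nonneg s₀]
  have hc₁ : c₁ ^ 2 ≤ 1 := by nlinarith [sq_nonneg s₁]
  have hc₂ : c₂ ^ 2 ≤ 1 := by nlinarith [sq_nonneg s₂]
  have hs₀ : s₀ ^ 2 ≤ 1 := by nlinarith [sq_nonneg c₀]
  have hs₁ : s₁ ^ 2 ≤ 1 := by nlinarith [sq_nonneg c₁]
  have hs₂ : s₂ ^ 2 ≤ 1 := by nlinarith [sq_nonneg c₂]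
  by_cases z₀ : c₀ = 0
  · subst z₀
    have := edge hp₀ hc₁ hc₂ hs₀
    simpa using this
  by_cases z₁ : c₁ = 0
  · subst z₁
    have := edge hp₁ hc₂ hc₀ hs₁
    simpa using this
  by_cases z₂ : c₂ = 0
  · subst z₂
    have := edge hp₂ hc₀ hc₁ hs₂
    simpa using this
  set C := c₀ * c₁ * c₂ with hC
  set X := c₁ * c₂ * s₀ with hX
  set Y := c₂ * c₀ * s₁ with hY
  set Z := c₀ * c₁ * s₂ with hZ
  have hCpos : 0 < C ^ 2 := by
    have : C ≠ 0 := mul_ne_zero (mul_ne_zero z₀ z₁) z₂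
    positivity
  have hCS : (p₀ ^ 2 * X + p₁ ^ 2 * Y + p₂ ^ 2 * Z) ^ 2 ≤
      (p₀ ^ 4 + p₁ ^ 4 + p₂ ^ 4) * (X ^ 2 + Y ^ 2 + Z ^ 2) := by
    nlinarith [sq_nonneg (p₀ ^ 2 * Y - p₁ ^ 2 * X), sq_nonneg (p₀ ^ 2 * Z - p₂ ^ 2 * X),
      sq_nonneg (p₁ ^ 2 * Z - p₂ ^ 2 * Y)]
  have hXYZ : 0 ≤ X ^ 2 + Y ^ 2 + Z ^ 2 := by positivity
  have hle : (p₀ ^ 4 + p₁ ^ 4 + p₂ ^ 4) * (X ^ 2 + Y ^ 2 + Z ^ 2) ≤ X ^ 2 + Y ^ 2 + Z ^ 2 :=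
    mul_le_of_le_one_left hXYZ hp
  have hone : C ^ 2 + (X ^ 2 + Y ^ 2 + Z ^ 2) ≤ 1 := by
    have h : (1 : ℝ) = (c₀ ^ 2 + s₀ ^ 2) * (c₁ ^ 2 + s₁ ^ 2) * (c₂ ^ 2 + s₂ ^ 2) := by
      rw [h₀, h₁, h₂]; ring
    have h' : (c₀ ^ 2 + s₀ ^ 2) * (c₁ ^ 2 + s₁ ^ 2) * (c₂ ^ 2 + s₂ ^ 2) =
        C ^ 2 + (X ^ 2 + Y ^ 2 + Z ^ 2) + ((c₀ * s₁ * s₂) ^ 2 + (c₁ * s₀ * s₂) ^ 2 +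
          (c₂ * s₀ * s₁) ^ 2 + (s₀ * s₁ * s₂) ^ 2) := by
      rw [hC, hX, hY, hZ]; ring
    rw [h, h']
    have : 0 ≤ (c₀ * s₁ * s₂) ^ 2 + (c₁ * s₀ * s₂) ^ 2 +
          (c₂ * s₀ * s₁) ^ 2 + (s₀ * s₁ * s₂) ^ 2 := by positivity
    linarith
  have hS2 : (S * C) ^ 2 < C ^ 2 := by
    rw [mul_pow]
    have : S ^ 2 < 1 := pow_lt_one₀ hS0 hS1 two_ne_zero
    exact mul_lt_of_lt_one_left hCpos this
  linarith

/-- Multiplying by the conjugates of all three unimodular factors makes the cubic term's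
trigonometric factor real and leaves one conjugate factor in each quadratic term. -/
lemma trig_corr_eq (q₀ q₁ q₂ T : ℂ) (c s : Fin 3 → ℝ)
    (h : ∀ j, c j ^ 2 + s j ^ 2 = 1) :
    ‖q₀ * ((c 1 : ℂ) * (c 1 + s 1 * Complex.I)) * ((c 2 : ℂ) * (c 2 + s 2 * Complex.I)) +
      q₁ * ((c 2 : ℂ) * (c 2 + s 2 * Complex.I)) * ((c 0 : ℂ) * (c 0 + s 0 * Complex.I)) +
      q₂ * ((c 0 : ℂ) * (c 0 + s 0 * Complex.I)) * ((c 1 : ℂ) * (c 1 + s 1 * Complex.I)) -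
      T * (((c 0 : ℂ) * (c 0 + s 0 * Complex.I)) * ((c 1 : ℂ) * (c 1 + s 1 * Complex.I)) *
        ((c 2 : ℂ) * (c 2 + s 2 * Complex.I)))‖ =
    ‖q₀ * (c 1 * c 2 * (c 0 - s 0 * Complex.I)) + q₁ * (c 2 * c 0 * (c 1 - s 1 * Complex.I)) +
      q₂ * (c 0 * c 1 * (c 2 - s 2 * Complex.I)) - T * (c 0 * c 1 * c 2)‖ := by
  have hI := Complex.I_sq
  have hu : ∀ j, ((c j : ℂ) + s j * Complex.I) * (c j - s j * Complex.I) = 1 := fun j => by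
    have : ((c j : ℂ)) ^ 2 + (s j : ℂ) ^ 2 = 1 := by exact_mod_cast h j
    linear_combination this - (s j : ℂ) ^ 2 * hI
  have hn : ∀ j, ‖(c j : ℂ) + s j * Complex.I‖ = 1 := fun j => by
    rw [← sq_eq_sq₀ (norm_nonneg _) zero_le_one, Complex.sq_norm, Complex.normSq_add_mul_I, h j,
      one_pow]
  have : ∀ w : ℂ, ‖w‖ = ‖((c 0 : ℂ) + s 0 * Complex.I) * ((c 1 : ℂ) + s 1 * Complex.I) *
      ((c 2 : ℂ) + s 2 * Complex.I) * w‖ := fun w => by simp [hn]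
  rw [this (q₀ * (c 1 * c 2 * (c 0 - s 0 * Complex.I)) + _ + _ - _)]
  congr 1
  have h0 := hu 0
  have h1 := hu 1
  have h2 := hu 2
  generalize (c 0 : ℂ) + s 0 * Complex.I = e0 at *
  generalize (c 1 : ℂ) + s 1 * Complex.I = e1 at *
  generalize (c 2 : ℂ) + s 2 * Complex.I = e2 at *
  linear_combination -q₀ * c 1 * c 2 * e1 * e2 * h0 - q₁ * c 2 * c 0 * e2 * e0 * h1 -
    q₂ * c 0 * c 1 * e0 * e1 * h2

lemma continuous_rhoSq {n : Fin 3 → ℕ} (Θ : Matrix (Fin 3) (Fin 3) ℝ)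
    (a : (j : Fin 3) → Fin (n j) → ℝ) : Continuous (rhoSq Θ a) := by
  unfold rhoSq circlePoint
  fun_prop

/-- The expression equals `(p₀ - p₁ p₂)² + p₁² (1 - p₂²) + p₂²`. -/
lemma corr_sq_nonneg (p₀ p₁ : ℝ) {p₂ : ℝ} (h : p₂ ^ 2 < 1) :
    0 ≤ p₀ ^ 2 + p₁ ^ 2 + p₂ ^ 2 - 2 * (p₀ * p₁ * p₂) := by
  nlinarith [sq_nonneg (p₀ - p₁ * p₂), sq_nonneg p₂, mul_nonneg (sq_nonneg p₁) (sub_nonneg.2 h.le)]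

lemma affine_lt_one {A B d : ℝ} (h0 : B < 1) (h1 : A + B < 1) (hd : 0 ≤ d ∧ d ≤ 1) :
    A * d + B < 1 := by
  rcases hd.2.lt_or_eq with h | h
  · nlinarith [mul_le_mul_of_nonneg_left h1.le hd.1, mul_lt_mul_of_pos_left h0 (sub_pos.2 h)]
  · rw [h, mul_one]; exact h1

/-- The left side is affine in each `d` separately, so endpoint values suffice. All `d = 1` gives
the hypothesis `hdet`; setting one `d` to `0` leaves a single squared correlation times factors in
`[0, 1]`. -/
lemma scaled_corr_lt_one {t₀ t₁ t₂ : ℝ} {d₀ d₁ d₂ : ℝ} (h₀ : t₀ ^ 2 < 1) (h₁ : t₁ ^ 2 < 1)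
    (h₂ : t₂ ^ 2 < 1) (hd₀ : 0 ≤ d₀ ∧ d₀ ≤ 1) (hd₁ : 0 ≤ d₁ ∧ d₁ ≤ 1) (hd₂ : 0 ≤ d₂ ∧ d₂ ≤ 1)
    (hdet : t₀ ^ 2 + t₁ ^ 2 + t₂ ^ 2 - 2 * (t₀ * t₁ * t₂) < 1) :
    t₀ ^ 2 * (d₁ * d₂) + t₁ ^ 2 * (d₂ * d₀) + t₂ ^ 2 * (d₀ * d₁) -
      2 * (t₀ * t₁ * t₂ * (d₀ * d₁ * d₂)) < 1 := by
  have a0 : ∀ d, 0 ≤ d ∧ d ≤ 1 → t₀ ^ 2 * d < 1 := fun d hd => by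
    simpa using affine_lt_one (A := t₀ ^ 2) (B := 0) one_pos (by linarith) hd
  have a1 : ∀ d, 0 ≤ d ∧ d ≤ 1 → t₁ ^ 2 * d < 1 := fun d hd => by
    simpa using affine_lt_one (A := t₁ ^ 2) (B := 0) one_pos (by linarith) hd
  have a2 : (t₁ ^ 2 + t₀ ^ 2 - 2 * (t₀ * t₁ * t₂)) * d₂ + t₂ ^ 2 < 1 :=
    affine_lt_one h₂ (by linarith) hd₂
  have a3 : (t₀ ^ 2 * d₂ + t₂ ^ 2 - 2 * (t₀ * t₁ * t₂) * d₂) * d₁ + t₁ ^ 2 * d₂ < 1 :=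
    affine_lt_one (a1 d₂ hd₂) (by linarith) hd₁
  have a4 : t₀ ^ 2 * (d₁ * d₂) < 1 :=
    a0 _ ⟨mul_nonneg hd₁.1 hd₂.1, mul_le_one₀ hd₁.2 hd₂.1 hd₂.2⟩
  have a5 := affine_lt_one (A := t₁ ^ 2 * d₂ + t₂ ^ 2 * d₁ - 2 * (t₀ * t₁ * t₂) * (d₁ * d₂))
    a4 (by linarith) hd₀
  linarith

lemma IsNonsingularCorrelation.symm_apply {ι : Type*} [Fintype ι] [DecidableEq ι]
    {Θ : Matrix ι ι ℝ} (hΘ : IsNonsingularCorrelation Θ) (i j : ι) : Θ i j = Θ j i := by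
  simpa using (hΘ.1.1.apply i j).symm

lemma IsNonsingularCorrelation.sq_lt_one {ι : Type*} [Fintype ι] [DecidableEq ι]
    {Θ : Matrix ι ι ℝ} (hΘ : IsNonsingularCorrelation Θ) {i j : ι} (hij : i ≠ j) :
    Θ i j ^ 2 < 1 := by
  have hinj : Function.Injective ![i, j] := by
    intro k l h
    fin_cases k <;> fin_cases l <;> simp_all
  have h := (hΘ.1.submatrix hinj).det_pos
  rw [Matrix.det_fin_two] at h
  simp only [Matrix.submatrix_apply, Matrix.cons_val_zero, Matrix.cons_val_one, hΘ.2] at h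
  rw [hΘ.symm_apply j i] at h
  nlinarith

/-- This is `det Θ > 0` written out. -/
lemma IsNonsingularCorrelation.det_bound {Θ : Matrix (Fin 3) (Fin 3) ℝ}
    (hΘ : IsNonsingularCorrelation Θ) :
    oppositeCorr Θ 0 ^ 2 + oppositeCorr Θ 1 ^ 2 + oppositeCorr Θ 2 ^ 2 -
      2 * (oppositeCorr Θ 0 * oppositeCorr Θ 1 * oppositeCorr Θ 2) < 1 := by
  have o0 : oppositeCorr Θ 0 = Θ 1 2 := rfl
  have o1 : oppositeCorr Θ 1 = Θ 2 0 := rfl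
  have o2 : oppositeCorr Θ 2 = Θ 0 1 := rfl
  have h := hΘ.1.det_pos
  rw [Matrix.det_fin_three] at h
  simp only [hΘ.2, hΘ.symm_apply 1 0, hΘ.symm_apply 2 1, hΘ.symm_apply 0 2] at h
  rw [o0, o1, o2]
  linarith

lemma oppositeCorr_sq_lt_one {Θ : Matrix (Fin 3) (Fin 3) ℝ} (hΘ : IsNonsingularCorrelation Θ)
    (j : Fin 3) : oppositeCorr Θ j ^ 2 < 1 :=
  hΘ.sq_lt_one (by fin_cases j <;> decide)

lemma rhoSq_lt_one {n : Fin 3 → ℕ} {a : (j : Fin 3) → Fin (n j) → ℝ}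
    (ha : ∀ j i, 0 < a j i ∧ a j i < 1) {Θ : Matrix (Fin 3) (Fin 3) ℝ}
    (hΘ : IsNonsingularCorrelation Θ) (h : ∑ j : Fin 3, scaledCorr Θ a j ^ 4 ≤ 1)
    (γ : Fin 3 → ℝ) : rhoSq Θ a γ < 1 := by
  set t := oppositeCorr Θ with ht
  set d : Fin 3 → ℝ := fun j => blockRadius (a j) with hd
  have hd0 : ∀ j, 0 ≤ d j := fun j => blockRadius_nonneg (ha j)
  have hd1 : ∀ j, d j ≤ 1 := fun j => (blockRadius_lt_one (ha j)).le
  have ht1 : ∀ j, t j ^ 2 < 1 := oppositeCorr_sq_lt_one hΘ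
  set r : Fin 3 → ℝ := fun j => Real.sqrt (d j) with hr
  have hr2 : ∀ j, r j ^ 2 = d j := fun j => Real.sq_sqrt (hd0 j)
  have hq : ∀ i j k, (t i * (r j * r k)) ^ 2 = t i ^ 2 * (d j * d k) := fun i j k => by
    rw [← hr2 j, ← hr2 k]; ring
  have hq1 : ∀ i j k, (t i * (r j * r k)) ^ 2 < 1 := fun i j k => by
    rw [hq]
    have := mul_le_one₀ (hd1 j) (hd0 k) (hd1 k)
    exact (mul_le_of_le_one_right (sq_nonneg _) this).trans_lt (ht1 i)
  have hsc : ∀ j, scaledCorr Θ a j = t j * (r (j + 1) * r (j + 2)) := fun j => by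
    rw [scaledCorr, Real.sqrt_mul (hd0 _)]
  rw [Fin.sum_univ_three] at h
  have hsc0 : scaledCorr Θ a 0 = t 0 * (r 1 * r 2) := hsc 0
  have hsc1 : scaledCorr Θ a 1 = t 1 * (r 2 * r 0) := hsc 1
  have hsc2 : scaledCorr Θ a 2 = t 2 * (r 0 * r 1) := hsc 2
  rw [hsc0, hsc1, hsc2] at h
  -- `S` is the polynomial evaluated at the radii `d`. It can be written with the scaled
  -- correlations alone because each `√(d j)` occurs twice in their product.
  have hS0 := corr_sq_nonneg (t 0 * (r 1 * r 2)) (t 1 * (r 2 * r 0)) (hq1 2 0 1)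
  have hT : t 0 * (r 1 * r 2) * (t 1 * (r 2 * r 0)) * (t 2 * (r 0 * r 1)) =
      t 0 * t 1 * t 2 * (d 0 * d 1 * d 2) := by
    rw [← hr2 0, ← hr2 1, ← hr2 2]; ring
  have hS1 := scaled_corr_lt_one (ht1 0) (ht1 1) (ht1 2) ⟨hd0 0, hd1 0⟩ ⟨hd0 1, hd1 1⟩
    ⟨hd0 2, hd1 2⟩ hΘ.det_bound
  rw [← hq 0 1 2, ← hq 1 2 0, ← hq 2 0 1, ← hT] at hS1
  have main := normSq_trig_corr_lt_one (Real.cos_sq_add_sin_sq (γ 0))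
    (Real.cos_sq_add_sin_sq (γ 1)) (Real.cos_sq_add_sin_sq (γ 2)) (hq1 0 1 2) (hq1 1 2 0)
    (hq1 2 0 1) hS0 hS1 h
  rw [hT, hq 0 1 2, hq 1 2 0, hq 2 0 1] at main
  refine lt_of_eq_of_lt ?_ main
  have hcp : ∀ j, circlePoint (a j) (γ j) = (d j : ℂ) * ((Real.cos (γ j) : ℂ) *
      ((Real.cos (γ j) : ℂ) + (Real.sin (γ j) : ℂ) * Complex.I)) := fun j => by
    rw [circlePoint, mul_comm Complex.I, Complex.exp_mul_I, Complex.ofReal_cos, Complex.ofReal_sin]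
    ring
  change ‖corrPoly Θ fun j => circlePoint (a j) (γ j)‖ ^ 2 = _
  have e := trig_corr_eq ((t 0 : ℂ) ^ 2 * (d 1 * d 2)) ((t 1 : ℂ) ^ 2 * (d 2 * d 0))
    ((t 2 : ℂ) ^ 2 * (d 0 * d 1)) (2 * (t 0 * t 1 * t 2 * (d 0 * d 1 * d 2)))
    (fun j => Real.cos (γ j)) (fun j => Real.sin (γ j)) fun j => Real.cos_sq_add_sin_sq (γ j)
  rw [corrPoly_eq]
  simp only [hcp]
  rw [← ht]
  have e' := congrArg (· ^ 2) e
  refine Eq.trans ?_ (e'.trans ?_)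
  · congr 2; ring
  · rw [Complex.sq_norm]
    generalize Real.cos (γ 0) = c₀
    generalize Real.cos (γ 1) = c₁
    generalize Real.cos (γ 2) = c₂
    generalize Real.sin (γ 0) = s₀
    generalize Real.sin (γ 1) = s₁
    generalize Real.sin (γ 2) = s₂
    have e2 : (t 0 : ℂ) ^ 2 * (d 1 * d 2) * (c₁ * c₂ * (c₀ - s₀ * Complex.I)) +
        (t 1 : ℂ) ^ 2 * (d 2 * d 0) * (c₂ * c₀ * (c₁ - s₁ * Complex.I)) +
        (t 2 : ℂ) ^ 2 * (d 0 * d 1) * (c₀ * c₁ * (c₂ - s₂ * Complex.I)) -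
        2 * (t 0 * t 1 * t 2 * (d 0 * d 1 * d 2)) * (c₀ * c₁ * c₂) =
        (((t 0 ^ 2 * (d 1 * d 2) + t 1 ^ 2 * (d 2 * d 0) + t 2 ^ 2 * (d 0 * d 1) -
          2 * (t 0 * t 1 * t 2 * (d 0 * d 1 * d 2))) * (c₀ * c₁ * c₂) : ℝ) : ℂ) +
        ((-(t 0 ^ 2 * (d 1 * d 2) * (c₁ * c₂ * s₀) + t 1 ^ 2 * (d 2 * d 0) * (c₂ * c₀ * s₁) +
          t 2 ^ 2 * (d 0 * d 1) * (c₀ * c₁ * s₂)) : ℝ) : ℂ) * Complex.I := by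
      push_cast; ring
    rw [e2, Complex.normSq_add_mul_I, neg_sq]

lemma maxRhoSqLtOne_of_sum_scaledCorr_le {n : Fin 3 → ℕ} {a : (j : Fin 3) → Fin (n j) → ℝ}
    (ha : ∀ j i, 0 < a j i ∧ a j i < 1) {Θ : Matrix (Fin 3) (Fin 3) ℝ}
    (hΘ : IsNonsingularCorrelation Θ) (h : ∑ j : Fin 3, scaledCorr Θ a j ^ 4 ≤ 1) :
    MaxRhoSqLtOne Θ a := by
  have hpi : -(Real.pi / 2) ≤ Real.pi / 2 := by linarith [Real.pi_pos]
  have hset : {γ : Fin 3 → ℝ | ∀ j, γ j ∈ Icc (-(Real.pi / 2)) (Real.pi / 2)} =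
      univ.pi fun _ => Icc (-(Real.pi / 2)) (Real.pi / 2) := by
    ext γ; exact ⟨fun h j _ => h j, fun h j => h j (mem_univ j)⟩
  have hK : IsCompact {γ : Fin 3 → ℝ | ∀ j, γ j ∈ Icc (-(Real.pi / 2)) (Real.pi / 2)} := by
    rw [hset]; exact isCompact_univ_pi fun _ => isCompact_Icc
  obtain ⟨γ, hγ, hmax⟩ := hK.exists_isMaxOn ⟨fun _ => Real.pi / 2, fun _ => ⟨hpi, le_rfl⟩⟩
    (continuous_rhoSq Θ a).continuousOn
  refine ⟨rhoSq Θ a γ, ⟨⟨γ, hγ, rfl⟩, ?_⟩, rhoSq_lt_one ha hΘ h γ⟩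
  rintro _ ⟨γ', hγ', rfl⟩
  exact hmax hγ'

theorem theorem5 (n : Fin 3 → ℕ) (a : (j : Fin 3) → Fin (n j) → ℝ)
    (ha : ∀ j i, 0 < a j i ∧ a j i < 1)
    (Θ : Matrix (Fin 3) (Fin 3) ℝ) (hΘ : IsNonsingularCorrelation Θ) :
    (MaxRhoSqLtOne Θ a →
      ∀ α : ℝ, 0 < α → ∀ μ : Measure (((j : Fin 3) × Fin (n j)) → ℝ),
        IsMultivariateGamma α (blockCorrelation Θ a) μ →
        ∀ x : ((j : Fin 3) × Fin (n j)) → ℝ,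
          HasSum (gammaSeriesTerm α Θ a x) (μ.real (Set.Iic x))) ∧
    (∑ j : Fin 3, scaledCorr Θ a j ^ 4 ≤ 1 → MaxRhoSqLtOne Θ a) := by
  exact ⟨fun hmax α hα μ hμ x => hasSum_gammaSeriesTerm hα ha hΘ hmax hμ x,
    maxRhoSqLtOne_of_sum_scaledCorr_le ha hΘ⟩
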